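/- Let $1\le k\le n$ be integers, let $\Omega\subset\mathbb{R}^n$ be open, and let $T$ be a normal $k$-current on $\Omega$, that is, a continuous linear functional on the smooth compactly supported $k$-forms on $\Omega$ such that both $T$ and its boundary $\partial T$ (defined by $\langle\partial T,\omega\rangle=\langle T,d\omega\rangle$) have finite mass. Write $T=\tau\mu$ and $\partial T=\tau'\mu'$, where $\mu,\mu'$ are locally finite positive Borel measures on $\Omega$, $\tau\in L^1(\mu)$ is a $k$-vectorfield with $\tau\neq0$ $\mu$-a.e., and $\tau'\in L^1(\mu')$ is a $(k-1)$-vectorfield with $\tau'\ne0$ $\mu'$-a.e.; this means $\langle T,\omega\rangle=\int_\Omega\langle\tau(x),\omega(x)\rangle\,d\mu(x)$ for every smooth compactly supported $k$-form $\omega$ on $\Omega$, and similarly for $\partial T$. Assume that (a) there is a real number $\alpha\in[k,n]$ such that $\mu\ll\mathscr{H}^\alpha$, where $\mathscr{H}^\alpha$ is the $\alpha$-dimensional Hausdorff measure; (b) there is a vectorfield $v$ of class $C^1$ on $\Omega$ such that $v\wedge\tau=0$ $\mu$-a.e. Let $E:=\{x\in\Omega : v(x)\wedge\tau'(x)\neq0\}$.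 Then the restriction of $\mu'$ to $E$ is absolutely continuous with respect to $\mathscr{H}^{\alpha-1}$. -/

import Mathlib

open MeasureTheory Set TopologicalSpace
open scoped Distributions

noncomputable section

/-- The Euclidean space `ℝⁿ`. -/
abbrev RSpace (n : ℕ) : Type := EuclideanSpace ℝ (Fin n)

/-- The space of `k`-vectors in `ℝⁿ`. -/
abbrev MultiVec (n k : ℕ) : Type := ⋀[ℝ]^k (RSpace n)

/-- The space of `k`-covectors on `ℝⁿ` (alternating `k`-linear forms). -/
abbrev Covec (n k : ℕ) : Type := RSpace n [⋀^Fin k]→L[ℝ] ℝ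

/-- The duality pairing of a `k`-vector and a `k`-covector, determined by
`⟨v₁ ∧ ⋯ ∧ vₖ, φ⟩ = φ (v₁, …, vₖ)`. -/
def multiPairing {n k : ℕ} (τ : MultiVec n k) (φ : Covec n k) : ℝ :=
  exteriorPower.alternatingMapLinearEquiv φ.toAlternatingMap τ

/-- The exterior product `v ∧ τ` of a vector `v` and a `k`-vector `τ`. -/
def vecWedge {n k : ℕ} (v : RSpace n) (τ : MultiVec n k) : MultiVec n (k + 1) :=
  ⟨ExteriorAlgebra.ι ℝ v * (τ : ExteriorAlgebra ℝ (RSpace n)), by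
    have h := Submodule.mul_mem_mul
      (LinearMap.mem_range_self (ExteriorAlgebra.ι ℝ (M := RSpace n)) v) τ.2
    rwa [← pow_succ'] at h⟩

/-- The Euclidean norm of a `k`-covector: the square root of the sum of the squares of its
coordinates with respect to the canonical basis `dx_{i₁} ∧ ⋯ ∧ dx_{iₖ}`, `i₁ < ⋯ < iₖ`. -/
def covecNorm {n k : ℕ} (φ : Covec n k) : ℝ :=
  Real.sqrt (∑ i : Fin k ↪o Fin n, (φ fun j => EuclideanSpace.single (i j) (1 : ℝ)) ^ 2)

/-- The smooth `k`-forms with compact support in `Ω`, with their usual (LF) topology. -/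
abbrev TestForm {n : ℕ} (Ω : Opens (RSpace n)) (k : ℕ) : Type := 𝓓(Ω, Covec n k)

/-- The `k`-currents on `Ω`. -/
abbrev Current {n : ℕ} (Ω : Opens (RSpace n)) (k : ℕ) : Type := TestForm Ω k →L[ℝ] ℝ

/-- The exterior derivative on smooth compactly supported forms; see `testExtDeriv_apply`. -/
def testExtDeriv {n : ℕ} (Ω : Opens (RSpace n)) (k : ℕ) :
    TestForm Ω k →L[ℝ] TestForm Ω (k + 1) :=
  (TestFunction.postcompCLM
    (ContinuousAlternatingMap.alternatizeUncurryFinCLM (n := k) ℝ (RSpace n) ℝ)).comp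
    (TestFunction.fderivCLM ℝ ⊤ ⊤)

theorem testExtDeriv_apply {n : ℕ} (Ω : Opens (RSpace n)) (k : ℕ) (ω : TestForm Ω k)
    (x : RSpace n) : testExtDeriv Ω k ω x = extDeriv ω x := by
  simp [testExtDeriv, extDeriv, ContinuousAlternatingMap.alternatizeUncurryFinCLM_apply]

namespace Current

variable {n k : ℕ} {Ω : Opens (RSpace n)}

/-- The boundary of a current: `⟨∂T, ω⟩ = ⟨T, dω⟩`. -/
def boundary (T : Current Ω (k + 1)) : Current Ω k :=
  T.comp (testExtDeriv Ω k)

/-- The mass of a current. -/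
def mass (T : Current Ω k) : ENNReal :=
  ⨆ (ω : TestForm Ω k) (_ : ∀ x ∈ Ω, covecNorm (ω x) ≤ 1), ENNReal.ofReal (T ω)

/-- A current is normal if it and its boundary have finite mass. -/
def IsNormal (T : Current Ω (k + 1)) : Prop :=
  T.mass < ⊤ ∧ T.boundary.mass < ⊤

/-- `T = τμ`, where `μ` is a locally finite positive Borel measure on `Ω` and `τ` is a
`k`-vectorfield in `L¹(μ)` which is nonzero `μ`-almost everywhere. Since the space of `k`-vectors
is finite dimensional, `τ` belongs to `L¹(μ)` precisely when all its pairings with fixed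
`k`-covectors do. -/
structure IsRepresentedBy (T : Current Ω k) (τ : Ω → MultiVec n k) (μ : Measure Ω) : Prop where
  locallyFinite : IsLocallyFiniteMeasure μ
  integrable : ∀ φ : Covec n k, Integrable (fun x => multiPairing (τ x) φ) μ
  ne_zero : ∀ᵐ x ∂μ, τ x ≠ 0
  eq_integral : ∀ ω : TestForm Ω k, T ω = ∫ x : Ω, multiPairing (τ x) (ω x) ∂μ

end Current

end

/-! Fix a compact set `F` that is null for the Hausdorff measure of dimension `α - 1`, and a
covector `η`. It is enough that `b = ⟨v ∧ τ', η⟩` has zero `μ'`-integral over every such `F`. Inner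
regularity then gives `b = 0` almost everywhere on every null Borel set, and finitely many `η`
detect whether `v ∧ τ'` vanishes.

Let `w` be `v` times a cutoff equal to 1 on `F`. Testing `∂T` against `f` times the interior product
of `η` by `w` produces all partial derivatives of `f`. Since `w ∧ τ = 0`, they collapse to the
single derivative of `f` along `w` (`multiPairing_covecWedge_curryLeft`), so that `∫ f b dμ' = ∫ f c
dμ + ∫ (∂f/∂w) ⟨τ, η⟩ dμ` for some `c` in `L¹(μ)` (`Current.integral_wedge_boundary`).

Only `∂f/∂w` matters, so `f` may be an average along the flow `Φ` of `w`. The function `∫₀^δ g(Φ_s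
x) ds` has derivative `g(Φ_δ x) - g(x)` along `w`, in which `g` is not differentiated
(`hasDerivAt_flowIntegral`). A commutator estimate for mollifiers admits such merely Lipschitz `f`.
Let `g` decrease to the indicator of the set swept by `F` during `[0, δ]`. Sweeping raises dimension
by at most one, so the set swept during `[-1, 1]` is null in dimension `α`, hence `μ`-null, and the
right-hand side disappears. Dividing by `δ` and letting `δ → 0` leaves `∫_F b dμ' = 0`
(`LieIdentity.setIntegral_eq_zero`). -/

noncomputable section

/-! ### Multilinear algebra: wedge and interior products, duality. -/

section Multivectors

variable {n k : ℕ}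

/-- The wedge product `ξ ∧ φ` of a linear form and a `k`-covector. -/
def covecWedge (ξ : RSpace n →L[ℝ] ℝ) (φ : Covec n k) : Covec n (k + 1) :=
  ContinuousAlternatingMap.alternatizeUncurryFin (ξ.smulRight φ)

theorem covecWedge_apply (ξ : RSpace n →L[ℝ] ℝ) (φ : Covec n k) (x : Fin (k + 1) → RSpace n) :
    covecWedge ξ φ x = ∑ i : Fin (k + 1), (-1 : ℝ) ^ (i : ℕ) * (ξ (x i) * φ (i.removeNth x)) := by
  simp [covecWedge, ContinuousAlternatingMap.alternatizeUncurryFin_apply]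

/-- The pairing with a fixed `k`-vector, as a linear form on `k`-covectors. -/
def pairingLeft (τ : MultiVec n k) : Covec n k →ₗ[ℝ] ℝ where
  toFun := multiPairing τ
  map_add' φ ψ := by simp [multiPairing]
  map_smul' c φ := by simp [multiPairing]

theorem pairingLeft_apply (τ : MultiVec n k) (φ : Covec n k) :
    pairingLeft τ φ = multiPairing τ φ := rfl

/-- The wedge product with a fixed vector, as a linear map on `k`-vectors. -/
def vecWedgeLin (v : RSpace n) : MultiVec n k →ₗ[ℝ] MultiVec n (k + 1) where
  toFun := vecWedge v
  map_add' τ σ := by ext; simp [vecWedge, mul_add]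
  map_smul' c τ := by ext; simp [vecWedge]

theorem vecWedge_smul (c : ℝ) (v : RSpace n) (τ : MultiVec n k) :
    vecWedge (c • v) τ = c • vecWedge v τ := by
  ext; simp [vecWedge]

theorem vecWedge_ιMulti (v : RSpace n) (a : Fin k → RSpace n) :
    vecWedge v (exteriorPower.ιMulti ℝ k a) =
      exteriorPower.ιMulti ℝ (k + 1) (Matrix.vecCons v a) := by
  ext
  simp [vecWedge, exteriorPower.ιMulti_apply_coe, ExteriorAlgebra.ιMulti_succ_apply]

/-- Interior product is adjoint to exterior product; by linearity it suffices to check decomposable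
multivectors. -/
theorem multiPairing_vecWedge (v : RSpace n) (τ : MultiVec n k) (η : Covec n (k + 1)) :
    multiPairing (vecWedge v τ) η = multiPairing τ (η.curryLeft v) := by
  have h : (exteriorPower.alternatingMapLinearEquiv η.toAlternatingMap) ∘ₗ vecWedgeLin v =
      exteriorPower.alternatingMapLinearEquiv (η.curryLeft v).toAlternatingMap := by
    apply exteriorPower.linearMap_ext
    ext a
    simp [vecWedgeLin, vecWedge_ιMulti]
  exact LinearMap.congr_fun h τ

/-- The antiderivation rule: in the alternating sum the term that feeds `v` to `ξ` splits off, and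
the other terms change sign by the index shift. -/
theorem curryLeft_covecWedge (ξ : RSpace n →L[ℝ] ℝ) (η : Covec n (k + 1)) (v : RSpace n) :
    (covecWedge ξ η).curryLeft v = ξ v • η - covecWedge ξ (η.curryLeft v) := by
  ext x
  rw [ContinuousAlternatingMap.curryLeft_apply_apply, covecWedge_apply, Fin.sum_univ_succ]
  simp only [ContinuousAlternatingMap.sub_apply, ContinuousAlternatingMap.smul_apply,
    covecWedge_apply]
  have h (i : Fin (k + 1)) : (Fin.succ i).removeNth (Matrix.vecCons v x) =
      Matrix.vecCons v (i.removeNth x) := by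
    ext j
    refine Fin.cases ?_ (fun j => ?_) j <;> simp [Fin.removeNth, Matrix.vecCons]
  have h0 : (0 : Fin (k + 2)).removeNth (Matrix.vecCons v x) = x := by
    ext j; simp [Fin.removeNth]
  simp only [h, h0, ContinuousAlternatingMap.curryLeft_apply_apply, sub_eq_add_neg,
    ← Finset.sum_neg_distrib]
  simp [pow_succ]

/-- Contracting `ξ ∧ η` with `v` and pairing with `τ` gives `⟨v ∧ τ, ξ ∧ η⟩ = 0`; the antiderivation
rule does the rest. With `ξ = df`, only the derivative of `f` along `v` survives. -/
theorem multiPairing_covecWedge_curryLeft {v : RSpace n} {τ : MultiVec n (k + 1)}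
    (h : vecWedge v τ = 0) (ξ : RSpace n →L[ℝ] ℝ) (η : Covec n (k + 1)) :
    multiPairing τ (covecWedge ξ (η.curryLeft v)) = ξ v * multiPairing τ η := by
  have h1 := multiPairing_vecWedge v τ (covecWedge ξ η)
  rw [h, curryLeft_covecWedge, ← pairingLeft_apply τ, map_sub, map_smul] at h1
  simp only [multiPairing, map_zero, smul_eq_mul] at h1
  change 0 = ξ v * multiPairing τ η - multiPairing τ (covecWedge ξ (η.curryLeft v)) at h1
  linarith

theorem continuous_multilinearMap_euclideanSpace
    (f : MultilinearMap ℝ (fun _ : Fin k => RSpace n) ℝ) : Continuous f := by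
  have h : (f : (Fin k → RSpace n) → ℝ) = fun x => ∑ r : Fin k → Fin n,
      (∏ i, x i (r i)) * f (fun i => EuclideanSpace.single (r i) (1 : ℝ)) := by
    funext x
    have hx : x = fun i => ∑ j, x i j • EuclideanSpace.single j (1 : ℝ) := by
      funext i
      simpa using ((EuclideanSpace.basisFun (Fin n) ℝ).sum_repr (x i)).symm
    conv_lhs => rw [hx, MultilinearMap.map_sum]
    exact Finset.sum_congr rfl fun r _ => by rw [MultilinearMap.map_smul_univ, smul_eq_mul]
  rw [h]
  fun_prop

/-- An alternating form on `ℝⁿ`, as a continuous one. -/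
def toCovec (f : RSpace n [⋀^Fin k]→ₗ[ℝ] ℝ) : Covec n k :=
  { f with cont := continuous_multilinearMap_euclideanSpace f.toMultilinearMap }

/-- A dual basis works. It reduces a statement on multivector fields to finitely many scalar
densities. -/
theorem exists_finite_separating_covec (n k : ℕ) :
    ∃ (ι : Type) (_ : Fintype ι) (η : ι → Covec n k),
      ∀ τ : MultiVec n k, (∀ i, multiPairing τ (η i) = 0) → τ = 0 := by
  let b := Module.finBasis ℝ (MultiVec n k)
  refine ⟨Fin (Module.finrank ℝ (MultiVec n k)), inferInstance,
    fun i => toCovec (exteriorPower.alternatingMapLinearEquiv.symm (b.coord i)), fun τ h => ?_⟩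
  refine b.ext_elem fun i => ?_
  have := h i
  have h2 : multiPairing τ (toCovec (exteriorPower.alternatingMapLinearEquiv.symm (b.coord i))) =
      b.coord i τ := by
    change exteriorPower.alternatingMapLinearEquiv
      (exteriorPower.alternatingMapLinearEquiv.symm (b.coord i)) τ = _
    rw [LinearEquiv.apply_symm_apply]
  rw [h2] at this
  simpa using this

end Multivectors

/-! ### Mollification of functions differentiable along Lipschitz fields. -/

section Mollification

open Filter Metric
open scoped Topology NNReal ContDiff Convolution Pointwise

variable {E : Type*} [NormedAddCommGroup E] [InnerProductSpace ℝ E]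

/-- A smooth bump function supported in the ball of radius `1 / (m + 1)`. -/
def shrinkingBump (E : Type*) [NormedAddCommGroup E] [InnerProductSpace ℝ E] (m : ℕ) :
    ContDiffBump (0 : E) where
  rIn := 1 / ((m : ℝ) + 1) / 2
  rOut := 1 / ((m : ℝ) + 1)
  rIn_pos := by positivity
  rIn_lt_rOut := half_lt_self (by positivity)

variable [FiniteDimensional ℝ E] [MeasurableSpace E] [BorelSpace E]

/-- The convolution of `f` with a normalized bump function supported in the ball of radius
`1 / (m + 1)`. -/
def mollify (m : ℕ) (f : E → ℝ) : E → ℝ :=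
  (shrinkingBump E m).normed volume ⋆[ContinuousLinearMap.lsmul ℝ ℝ, volume] f

theorem mollify_apply (m : ℕ) (f : E → ℝ) (x : E) :
    mollify m f x = ∫ z, (shrinkingBump E m).normed volume z * f (x - z) := by
  simp [mollify, convolution]

theorem contDiff_mollify (m : ℕ) {f : E → ℝ} (hf : Continuous f) : ContDiff ℝ ∞ (mollify m f) :=
  (shrinkingBump E m).hasCompactSupport_normed.contDiff_convolution_left _
    (shrinkingBump E m).contDiff_normed hf.locallyIntegrable

theorem support_mollify_subset (m : ℕ) (f : E → ℝ) :
    Function.support (mollify m f) ⊆ cthickening (1 / ((m : ℝ) + 1)) (tsupport f) := by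
  refine (support_convolution_subset _).trans ?_
  rw [ContDiffBump.support_normed_eq, add_comm (ball _ _), add_ball_zero]
  exact (thickening_subset_cthickening _ _).trans
    (cthickening_subset_of_subset _ (subset_tsupport f))

theorem tendsto_mollify (f : E → ℝ) (hf : Continuous f) (x : E) :
    Tendsto (fun m => mollify m f x) atTop (𝓝 (f x)) :=
  ContDiffBump.convolution_tendsto_right_of_continuous
    (tendsto_one_div_add_atTop_nhds_zero_nat (𝕜 := ℝ)) hf x

theorem integrable_bump_mul (m : ℕ) {g : E → ℝ} (hg : Continuous g) :
    Integrable (fun z => (shrinkingBump E m).normed volume z * g z) := by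
  refine Continuous.integrable_of_hasCompactSupport
    ((shrinkingBump E m).continuous_normed.mul hg) ?_
  exact (shrinkingBump E m).hasCompactSupport_normed.mul_right

theorem abs_integral_bump_mul_le (m : ℕ) {g : E → ℝ} {C : ℝ}
    (h : ∀ z, ‖z‖ ≤ 1 / ((m : ℝ) + 1) → |g z| ≤ C) :
    |∫ z, (shrinkingBump E m).normed volume z * g z| ≤ C := by
  have hi : ∫ z, (shrinkingBump E m).normed (volume : Measure E) z * C = C := by
    rw [integral_mul_const, ContDiffBump.integral_normed, one_mul]
  rw [← hi, ← Real.norm_eq_abs]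
  refine norm_integral_le_of_norm_le
    ((shrinkingBump E m).integrable_normed (μ := volume) |>.mul_const C) (.of_forall fun z => ?_)
  rw [norm_mul, Real.norm_of_nonneg ((shrinkingBump E m).nonneg_normed z)]
  by_cases hz : z ∈ ball (0 : E) (1 / ((m : ℝ) + 1))
  · exact mul_le_mul_of_nonneg_left (h z (by simpa using (mem_ball_zero_iff.1 hz).le))
      ((shrinkingBump E m).nonneg_normed z)
  · have : (shrinkingBump E m).normed (volume : Measure E) z = 0 := by
      rw [← Function.notMem_support, ContDiffBump.support_normed_eq]
      exact hz
    simp [this]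

theorem abs_mollify_le (m : ℕ) {f : E → ℝ} {C : ℝ} (h : ∀ x, |f x| ≤ C) (x : E) :
    |mollify m f x| ≤ C := by
  rw [mollify_apply]
  exact abs_integral_bump_mul_le m fun z _ => h _

theorem lipschitzWith_mollify (m : ℕ) {f : E → ℝ} {L : ℝ≥0} (hf : LipschitzWith L f) :
    LipschitzWith L (mollify m f) := by
  refine LipschitzWith.of_dist_le_mul fun x y => ?_
  rw [Real.dist_eq, mollify_apply, mollify_apply, ← integral_sub]
  · simp_rw [← mul_sub]
    refine abs_integral_bump_mul_le m fun z _ => ?_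
    rw [← Real.dist_eq]
    simpa using hf.dist_le_mul (x - z) (y - z)
  all_goals exact integrable_bump_mul m (hf.continuous.comp (by fun_prop))

/-- Friedrichs commutator estimate. Differentiating the mollification moves `x - z` in the direction
`w x`, while mollifying the derivative moves it along `w (x - z)`. These directions differ by at
most `K‖z‖`, which costs a factor `L`; `f` needs a derivative only along `w`. -/
theorem abs_fderiv_mollify_sub_le (m : ℕ) {f : E → ℝ} {L K M : ℝ≥0} (hf : LipschitzWith L f)
    {w : E → E} (hw : LipschitzWith K w) (hM : ∀ x, ‖w x‖ ≤ M) {D : E → ℝ}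
    (hD : ∀ x, HasDerivAt (fun h : ℝ => f (x + h • w x)) (D x) 0) (x : E) :
    |fderiv ℝ (mollify m f) x (w x) - mollify m D x| ≤ L * K * (1 / ((m : ℝ) + 1)) := by
  set ρ := (shrinkingBump E m).normed (volume : Measure E) with hρ
  let h : ℕ → ℝ := fun j => 1 / ((j : ℝ) + 1)
  have h0 : ∀ j, 0 < h j := fun j => by positivity
  have hlim : Tendsto h atTop (𝓝[≠] 0) :=
    tendsto_nhdsWithin_iff.2 ⟨tendsto_one_div_add_atTop_nhds_zero_nat,
      .of_forall fun j => (h0 j).ne'⟩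
  have hA : Tendsto (fun j => (h j)⁻¹ * (mollify m f (x + h j • w x) - mollify m f x)) atTop
      (𝓝 (fderiv ℝ (mollify m f) x (w x))) := by
    have hd : HasFDerivAt (mollify m f) (fderiv ℝ (mollify m f) x) x :=
      ((contDiff_mollify m hf.continuous).differentiable (by simp) x).hasFDerivAt
    have := (hd.hasLineDerivAt (w x)).tendsto_slope_zero
    simpa [Function.comp_def] using this.comp hlim
  have hB : Tendsto (fun j => ∫ z, ρ z * ((h j)⁻¹ *
      (f (x - z + h j • w (x - z)) - f (x - z)))) atTop (𝓝 (mollify m D x)) := by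
    rw [mollify_apply]
    refine tendsto_integral_of_dominated_convergence (fun z => ρ z * (L * M)) (fun j => ?_)
      ((shrinkingBump E m).integrable_normed.mul_const _) (fun j => .of_forall fun z => ?_)
      (.of_forall fun z => ?_)
    · refine (integrable_bump_mul m ?_).aestronglyMeasurable
      have := hf.continuous
      have := hw.continuous
      fun_prop
    · rw [norm_mul, Real.norm_of_nonneg ((shrinkingBump E m).nonneg_normed z)]
      refine mul_le_mul_of_nonneg_left ?_ ((shrinkingBump E m).nonneg_normed z)
      rw [norm_mul, norm_inv, Real.norm_of_nonneg (h0 j).le, inv_mul_le_iff₀ (h0 j)]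
      have := hf.dist_le_mul (x - z + h j • w (x - z)) (x - z)
      rw [dist_self_add_left, norm_smul, Real.norm_of_nonneg (h0 j).le, dist_eq_norm] at this
      refine this.trans ?_
      have := mul_le_mul_of_nonneg_left (hM (x - z)) (mul_nonneg L.coe_nonneg (h0 j).le)
      linarith
    · refine Tendsto.const_mul _ ?_
      have := (hD (x - z)).tendsto_slope_zero
      simpa [Function.comp_def] using this.comp hlim
  -- The two difference quotients are compared at the same step `h j`; the bound is uniform in `j`.
  refine le_of_tendsto (hA.sub hB).abs (.of_forall fun j => ?_)
  have hc := hf.continuous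
  have hwc := hw.continuous
  rw [mollify_apply, mollify_apply, ← integral_sub, ← integral_const_mul, ← integral_sub]
  · have : ∀ z, (h j)⁻¹ * (ρ z * f (x + h j • w x - z) - ρ z * f (x - z)) -
        ρ z * ((h j)⁻¹ * (f (x - z + h j • w (x - z)) - f (x - z))) =
        ρ z * ((h j)⁻¹ * (f (x + h j • w x - z) - f (x - z + h j • w (x - z)))) := fun z => by ring
    simp_rw [← hρ, this]
    refine abs_integral_bump_mul_le m fun z hz => ?_
    rw [abs_mul, abs_inv, abs_of_pos (h0 j), inv_mul_le_iff₀ (h0 j), ← Real.dist_eq]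
    refine (hf.dist_le_mul _ _).trans ?_
    have e : x + h j • w x - z = x - z + h j • w x := by abel
    rw [e, dist_add_left, dist_eq_norm, ← smul_sub, norm_smul, Real.norm_of_nonneg (h0 j).le]
    have h1 : ‖w x - w (x - z)‖ ≤ K * (1 / ((m : ℝ) + 1)) := by
      have := hw.dist_le_mul x (x - z)
      rw [dist_eq_norm, dist_eq_norm, sub_sub_cancel] at this
      exact this.trans (mul_le_mul_of_nonneg_left hz K.coe_nonneg)
    have := mul_le_mul_of_nonneg_left h1 (mul_nonneg L.coe_nonneg (h0 j).le)
    linarith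
  · simp_rw [← mul_sub]
    refine (integrable_bump_mul m ?_).const_mul _
    fun_prop
  · refine integrable_bump_mul m ?_
    fun_prop
  · refine integrable_bump_mul m ?_
    fun_prop
  · refine integrable_bump_mul m ?_
    fun_prop

theorem tendsto_fderiv_mollify {f : E → ℝ} {L K M : ℝ≥0} (hf : LipschitzWith L f)
    {w : E → E} (hw : LipschitzWith K w) (hM : ∀ x, ‖w x‖ ≤ M) {D : E → ℝ} (hDc : Continuous D)
    (hD : ∀ x, HasDerivAt (fun h : ℝ => f (x + h • w x)) (D x) 0) (x : E) :
    Tendsto (fun m => fderiv ℝ (mollify m f) x (w x)) atTop (𝓝 (D x)) := by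
  have h1 : Tendsto (fun m => fderiv ℝ (mollify m f) x (w x) - mollify m D x) atTop (𝓝 0) := by
    refine squeeze_zero_norm (fun m => abs_fderiv_mollify_sub_le m hf hw hM hD x) ?_
    simpa using (tendsto_one_div_add_atTop_nhds_zero_nat (𝕜 := ℝ)).const_mul ((L : ℝ) * K)
  simpa using h1.add (tendsto_mollify D hDc x)

/-- An identity `∫ f b dμ' = ∫ f c dμ + ∑ j, ∫ (∂f/∂wⱼ) aⱼ dμ` extends from the mollifications of a
bounded Lipschitz function `f` to `f` itself, when `f` has continuous derivatives along the
Lipschitz fields `wⱼ`. -/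
theorem integral_identity_of_mollify {X ι : Type*} [Fintype ι] [TopologicalSpace X]
    [MeasurableSpace X] [OpensMeasurableSpace X]
    {μ μ' : Measure X} {p : X → E} (hp : Continuous p) {b c : X → ℝ} {a : ι → X → ℝ}
    (hb : Integrable b μ') (hc : Integrable c μ) (ha : ∀ j, Integrable (a j) μ)
    {w : ι → E → E} {K M : ℝ≥0} (hw : ∀ j, LipschitzWith K (w j)) (hM : ∀ j x, ‖w j x‖ ≤ M)
    {f : E → ℝ} {L : ℝ≥0} {C : ℝ} (hf : LipschitzWith L f) (hC : ∀ x, |f x| ≤ C)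
    {D : ι → E → ℝ} (hDc : ∀ j, Continuous (D j))
    (hD : ∀ j x, HasDerivAt (fun h : ℝ => f (x + h • w j x)) (D j x) 0)
    (h : ∀ᶠ m in atTop, ∫ x, mollify m f (p x) * b x ∂μ' =
      ∫ x, mollify m f (p x) * c x ∂μ +
        ∑ j, ∫ x, fderiv ℝ (mollify m f) (p x) (w j (p x)) * a j x ∂μ) :
    ∫ x, f (p x) * b x ∂μ' = ∫ x, f (p x) * c x ∂μ + ∑ j, ∫ x, D j (p x) * a j x ∂μ := by
  have hcont m : Continuous (mollify m f) := (contDiff_mollify m hf.continuous).continuous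
  have key (ν : Measure X) (g : X → ℝ) (hg : Integrable g ν) :
      Tendsto (fun m => ∫ x, mollify m f (p x) * g x ∂ν) atTop (𝓝 (∫ x, f (p x) * g x ∂ν)) := by
    refine tendsto_integral_of_dominated_convergence (fun x => C * ‖g x‖) (fun m => ?_)
      (hg.norm.const_mul C) (fun m => .of_forall fun x => ?_) (.of_forall fun x => ?_)
    · exact ((hcont m).comp hp).aestronglyMeasurable.mul hg.aestronglyMeasurable
    · rw [norm_mul]
      exact mul_le_mul_of_nonneg_right (abs_mollify_le m hC _) (norm_nonneg _)
    · exact (tendsto_mollify f hf.continuous _).mul_const _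
  have key2 (j : ι) : Tendsto (fun m => ∫ x, fderiv ℝ (mollify m f) (p x) (w j (p x)) * a j x ∂μ)
      atTop (𝓝 (∫ x, D j (p x) * a j x ∂μ)) := by
    refine tendsto_integral_of_dominated_convergence (fun x => (L * M : ℝ) * ‖a j x‖) (fun m => ?_)
      ((ha j).norm.const_mul _) (fun m => .of_forall fun x => ?_) (.of_forall fun x => ?_)
    · refine (Continuous.aestronglyMeasurable ?_).mul (ha j).aestronglyMeasurable
      have h1 : Continuous (fderiv ℝ (mollify m f)) :=
        (contDiff_mollify m hf.continuous).continuous_fderiv (by simp)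
      exact (h1.comp hp).clm_apply ((hw j).continuous.comp hp)
    · rw [norm_mul]
      refine mul_le_mul_of_nonneg_right ?_ (norm_nonneg _)
      refine (ContinuousLinearMap.le_opNorm _ _).trans ?_
      exact mul_le_mul (norm_fderiv_le_of_lipschitz ℝ (lipschitzWith_mollify m hf)) (hM j _)
        (norm_nonneg _) L.coe_nonneg
    · exact (tendsto_fderiv_mollify hf (hw j) (hM j) (hDc j) (hD j) _).mul_const _
  exact tendsto_nhds_unique_of_eventuallyEq (key μ' b hb)
    ((key μ c hc).add (tendsto_finsetSum _ fun j _ => key2 j)) h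

end Mollification

/-! ### The boundary of a current tested against functions times constant covectors. -/

section Currents

open Filter Metric
open scoped Topology NNReal ContDiff

variable {n k : ℕ} {Ω : Opens (RSpace n)}

theorem covecWedge_sum_smul_proj (ξ : RSpace n →L[ℝ] ℝ) (φ : Covec n k) :
    covecWedge ξ φ = ∑ j, ξ (EuclideanSpace.single j 1) • covecWedge (EuclideanSpace.proj j) φ := by
  have hξ (x : RSpace n) : ξ x = ∑ j, ξ (EuclideanSpace.single j 1) * x j := by
    conv_lhs => rw [← (EuclideanSpace.basisFun (Fin n) ℝ).sum_repr x, map_sum]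
    simp [mul_comm]
  ext x
  rw [covecWedge_apply, ContinuousAlternatingMap.sum_apply]
  simp_rw [ContinuousAlternatingMap.smul_apply, covecWedge_apply, smul_eq_mul, Finset.mul_sum]
  rw [Finset.sum_comm]
  refine Finset.sum_congr rfl fun i _ => ?_
  rw [hξ (x i), Finset.sum_mul, Finset.mul_sum]
  refine Finset.sum_congr rfl fun j _ => ?_
  simp only [PiLp.proj_apply]
  ring

theorem multiPairing_covecWedge (τ : MultiVec n (k + 1)) (ξ : RSpace n →L[ℝ] ℝ) (φ : Covec n k) :
    multiPairing τ (covecWedge ξ φ) = ∑ j, ξ (EuclideanSpace.single j 1) *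
      multiPairing τ (covecWedge (EuclideanSpace.proj j) φ) := by
  rw [covecWedge_sum_smul_proj, ← pairingLeft_apply, map_sum]
  simp [pairingLeft_apply]

theorem curryLeft_eq_sum (η : Covec n (k + 1)) (v : RSpace n) :
    η.curryLeft v = ∑ i, v i • η.curryLeft (EuclideanSpace.single i 1) := by
  conv_lhs => rw [← (EuclideanSpace.basisFun (Fin n) ℝ).sum_repr v, map_sum]
  simp

theorem multiPairing_curryLeft (τ : MultiVec n k) (η : Covec n (k + 1)) (v : RSpace n) :
    multiPairing τ (η.curryLeft v) =
      ∑ i, v i * multiPairing τ (η.curryLeft (EuclideanSpace.single i 1)) := by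
  rw [curryLeft_eq_sum, ← pairingLeft_apply, map_sum]
  simp [pairingLeft_apply]

/-- The wedge product with a fixed linear form, as a linear map on `k`-covectors. -/
def covecWedgeLin (ξ : RSpace n →L[ℝ] ℝ) : Covec n k →ₗ[ℝ] Covec n (k + 1) where
  toFun := covecWedge ξ
  map_add' φ ψ := by
    ext x; simp [covecWedge_apply, mul_add, Finset.sum_add_distrib]
  map_smul' c φ := by
    ext x; simp [covecWedge_apply, Finset.mul_sum, mul_left_comm]

theorem multiPairing_covecWedge_curryLeft_eq_sum (τ : MultiVec n (k + 1)) (ξ : RSpace n →L[ℝ] ℝ)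
    (η : Covec n (k + 1)) (v : RSpace n) :
    multiPairing τ (covecWedge ξ (η.curryLeft v)) = ∑ i, v i *
      multiPairing τ (covecWedge ξ (η.curryLeft (EuclideanSpace.single i 1))) := by
  change (pairingLeft τ ∘ₗ covecWedgeLin ξ) (η.curryLeft v) = _
  rw [curryLeft_eq_sum, map_sum]
  simp_rw [map_smul]
  rfl

variable {T : Current Ω (k + 1)} {τ : Ω → MultiVec n (k + 1)} {μ : Measure Ω}
  {τ' : Ω → MultiVec n k} {μ' : Measure Ω}

/-- Uses `d(fφ) = df ∧ φ` for constant `φ`. Expanding `df` in coordinates leaves pairings with fixed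
covectors, whose integrability is known. -/
theorem Current.integral_boundary_of_contDiff (hτ : T.IsRepresentedBy τ μ)
    (hτ' : T.boundary.IsRepresentedBy τ' μ') {f : RSpace n → ℝ} (hf : ContDiff ℝ ∞ f)
    (hfc : HasCompactSupport f) (hfΩ : tsupport f ⊆ Ω) (φ : Covec n k) :
    ∫ x : Ω, f x * multiPairing (τ' x) φ ∂μ' =
      ∑ j, ∫ x : Ω, fderiv ℝ f x (EuclideanSpace.single j 1) *
        multiPairing (τ x) (covecWedge (EuclideanSpace.proj j) φ) ∂μ := by
  let θ : TestForm Ω k :=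
    { toFun := fun x => f x • φ
      contDiff' := hf.smul contDiff_const
      hasCompactSupport' := hfc.smul_right
      tsupport_subset' := (tsupport_smul_subset_left _ _).trans hfΩ }
  have hθ : (θ : RSpace n → Covec n k) = fun x => f x • φ := rfl
  have hdf : Continuous (fderiv ℝ f) := hf.continuous_fderiv (by simp)
  have hdc : HasCompactSupport (fderiv ℝ f) := hfc.fderiv ℝ
  have h1 : T.boundary θ = ∫ x : Ω, f x * multiPairing (τ' x) φ ∂μ' := by
    rw [hτ'.eq_integral]
    refine integral_congr_ae (.of_forall fun x => ?_)
    simp only [hθ]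
    rw [← pairingLeft_apply, map_smul, smul_eq_mul, pairingLeft_apply]
  have h2 (x : RSpace n) : testExtDeriv Ω k θ x = covecWedge (fderiv ℝ f x) φ := by
    rw [testExtDeriv_apply, extDeriv, hθ,
      fderiv_smul_const (hf.differentiable (by simp) x)]
    rfl
  rw [← h1]
  change T (testExtDeriv Ω k θ) = _
  rw [hτ.eq_integral, ← integral_finsetSum]
  · refine integral_congr_ae (.of_forall fun x => ?_)
    simp only [h2]
    exact multiPairing_covecWedge _ _ _
  · intro j _
    obtain ⟨C, hC⟩ := hdc.exists_bound_of_continuous hdf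
    refine (hτ.integrable _).bdd_mul (c := C) ?_ (.of_forall fun x => ?_)
    · exact ((hdf.comp continuous_subtype_val).clm_apply continuous_const).aestronglyMeasurable
    · refine (ContinuousLinearMap.le_opNorm _ _).trans ?_
      simpa using hC x

/-- Needed because the coefficients `f wᵢ` used later are only `C¹`. -/
theorem Current.integral_boundary_of_contDiff_one (hτ : T.IsRepresentedBy τ μ)
    (hτ' : T.boundary.IsRepresentedBy τ' μ') {f : RSpace n → ℝ} (hf : ContDiff ℝ 1 f)
    (hfc : HasCompactSupport f) (hfΩ : tsupport f ⊆ Ω) (φ : Covec n k) :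
    ∫ x : Ω, f x * multiPairing (τ' x) φ ∂μ' =
      ∑ j, ∫ x : Ω, fderiv ℝ f x (EuclideanSpace.single j 1) *
        multiPairing (τ x) (covecWedge (EuclideanSpace.proj j) φ) ∂μ := by
  obtain ⟨L, hL⟩ := hf.lipschitzWith_of_hasCompactSupport hfc (by simp)
  obtain ⟨C, hC⟩ := hfc.exists_bound_of_continuous hf.continuous
  obtain ⟨δ, hδ, hδΩ⟩ := hfc.isCompact.exists_cthickening_subset_open Ω.isOpen hfΩ
  -- The fields are the constant coordinate vectors, hence `K = 0` and `M = 1`; there is no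
  -- zeroth-order term.
  have := integral_identity_of_mollify (μ := μ) (μ' := μ') (p := ((↑) : Ω → RSpace n))
    continuous_subtype_val (hτ'.integrable φ) (integrable_zero _ _ _)
    (fun j => hτ.integrable (covecWedge (EuclideanSpace.proj j) φ)) (K := 0) (M := 1)
    (w := fun j _ => EuclideanSpace.single j 1) (fun j => LipschitzWith.const _) (by simp) hL hC
    (D := fun j x => fderiv ℝ f x (EuclideanSpace.single j 1))
    (fun j => (hf.continuous_fderiv (by simp)).clm_apply continuous_const)
    (fun j x => ((hf.differentiable (by simp) x).hasFDerivAt.hasLineDerivAt _)) ?_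
  · simpa using this
  have hlim : ∀ᶠ m : ℕ in atTop, 1 / ((m : ℝ) + 1) < δ :=
    (tendsto_one_div_add_atTop_nhds_zero_nat (𝕜 := ℝ)).eventually (gt_mem_nhds hδ)
  filter_upwards [hlim] with m hm
  have hs : tsupport (mollify m f) ⊆ cthickening δ (tsupport f) :=
    closure_minimal ((support_mollify_subset m f).trans (cthickening_mono hm.le _))
      isClosed_cthickening
  rw [Current.integral_boundary_of_contDiff hτ hτ' (contDiff_mollify m hf.continuous)
    (hfc.isCompact.cthickening.of_isClosed_subset (isClosed_tsupport _) hs) (hs.trans hδΩ) φ]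
  simp

/-- If `w` is a compactly supported `C¹` field with `w ∧ τ = 0`, then
`w ∧ ∂T` is the Lie derivative of `T` along `w`, tested here against `f η` for a fixed covector
`η`. -/
theorem Current.integral_wedge_boundary (hτ : T.IsRepresentedBy τ μ)
    (hτ' : T.boundary.IsRepresentedBy τ' μ') {w : RSpace n → RSpace n} (hw : ContDiff ℝ 1 w)
    (hwc : HasCompactSupport w) (hwΩ : tsupport w ⊆ Ω)
    (hwτ : ∀ᵐ x : Ω ∂μ, vecWedge (w x) (τ x) = 0) (η : Covec n (k + 1)) :
    Integrable (fun x : Ω => multiPairing (vecWedge (w x) (τ' x)) η) μ' ∧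
    ∃ c : Ω → ℝ, Integrable c μ ∧ ∀ f : RSpace n → ℝ, ContDiff ℝ 1 f →
      ∫ x : Ω, f x * multiPairing (vecWedge (w x) (τ' x)) η ∂μ' =
        ∫ x : Ω, f x * c x ∂μ + ∫ x : Ω, fderiv ℝ f x (w x) * multiPairing (τ x) η ∂μ := by
  let e (i : Fin n) : RSpace n := EuclideanSpace.single i 1
  have hwi (i : Fin n) : ContDiff ℝ 1 fun x => w x i := by fun_prop
  have hwic (i : Fin n) : HasCompactSupport fun x => w x i :=
    hwc.comp_left (g := fun y : RSpace n => y i) (by simp)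
  have hwis (i : Fin n) : tsupport (fun x => w x i) ⊆ tsupport w :=
    closure_mono (Function.support_comp_subset (g := fun y : RSpace n => y i) (by simp) w)
  have key {ν : Measure Ω} {g : RSpace n → ℝ} {a : Ω → ℝ} (hg : Continuous g)
      (hgc : HasCompactSupport g) (ha : Integrable a ν) :
      Integrable (fun x : Ω => g x * a x) ν := by
    obtain ⟨C, hC⟩ := hgc.exists_bound_of_continuous hg
    exact ha.bdd_mul (c := C) (hg.comp continuous_subtype_val).aestronglyMeasurable
      (.of_forall fun x => hC x)
  have hb (x : Ω) : multiPairing (vecWedge (w x) (τ' x)) η =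
      ∑ i, w x i * multiPairing (τ' x) (η.curryLeft (e i)) := by
    rw [multiPairing_vecWedge, multiPairing_curryLeft]
  have hdw (i j : Fin n) : Continuous fun x => fderiv ℝ (fun y => w y i) x (e j) :=
    ((hwi i).continuous_fderiv (by simp)).clm_apply continuous_const
  have hdwc (i j : Fin n) : HasCompactSupport fun x => fderiv ℝ (fun y => w y i) x (e j) :=
    (hwic i).fderiv_apply ℝ (e j)
  let a (i j : Fin n) (x : Ω) : ℝ :=
    multiPairing (τ x) (covecWedge (EuclideanSpace.proj j) (η.curryLeft (e i)))
  have ha (i j : Fin n) : Integrable (a i j) μ := hτ.integrable _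
  refine ⟨?_, fun x => ∑ i, ∑ j, fderiv ℝ (fun y => w y i) x (e j) * a i j x, ?_, ?_⟩
  -- The density `c` collects the terms of the product rule for `f wᵢ` in which the derivative falls
  -- on `wᵢ`.
  · simp_rw [hb]
    exact integrable_finsetSum _ fun i _ => key (hwi i).continuous (hwic i) (hτ'.integrable _)
  · exact integrable_finsetSum _ fun i _ => integrable_finsetSum _ fun j _ =>
      key (hdw i j) (hdwc i j) (ha i j)
  intro f hf
  have hfw (i : Fin n) : ContDiff ℝ 1 fun x => f x * w x i := hf.mul (hwi i)
  have hfwc (i : Fin n) : HasCompactSupport fun x => f x * w x i := (hwic i).mul_left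
  have hdf (j : Fin n) : Continuous fun x => fderiv ℝ f x (e j) :=
    (hf.continuous_fderiv (by simp)).clm_apply continuous_const
  have hI1 (i j : Fin n) : Integrable (fun x : Ω =>
      f x * (fderiv ℝ (fun y => w y i) x (e j) * a i j x)) μ := by
    simpa only [Pi.mul_apply, mul_assoc] using key (hf.continuous.mul (hdw i j)) (hdwc i j).mul_left (ha i j)
  have hI2 (i j : Fin n) : Integrable (fun x : Ω => w x i * fderiv ℝ f x (e j) * a i j x) μ :=
    key ((hwi i).continuous.mul (hdf j)) (hwic i).mul_right (ha i j)
  have hlhs : ∫ x : Ω, f x * multiPairing (vecWedge (w x) (τ' x)) η ∂μ' =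
      ∑ i, ∑ j, ∫ x : Ω, (f x * (fderiv ℝ (fun y => w y i) x (e j) * a i j x) +
        w x i * fderiv ℝ f x (e j) * a i j x) ∂μ := by
    simp_rw [hb, Finset.mul_sum, ← mul_assoc]
    rw [integral_finsetSum _ fun i _ => key (hfw i).continuous (hfwc i) (hτ'.integrable _)]
    refine Finset.sum_congr rfl fun i _ => ?_
    rw [Current.integral_boundary_of_contDiff_one hτ hτ' (hfw i) (hfwc i)
      ((tsupport_mul_subset_right.trans (hwis i)).trans hwΩ)]
    refine Finset.sum_congr rfl fun j _ => integral_congr_ae (.of_forall fun x => ?_)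
    simp only
    rw [fderiv_fun_mul (hf.differentiable (by simp) _) ((hwi i).differentiable (by simp) _)]
    simp only [add_apply, smul_apply, smul_eq_mul, a, e]
    ring
  have hrhs : ∫ x : Ω, fderiv ℝ f x (w x) * multiPairing (τ x) η ∂μ =
      ∑ i, ∑ j, ∫ x : Ω, w x i * fderiv ℝ f x (e j) * a i j x ∂μ := by
    simp_rw [← integral_finsetSum _ fun j _ => hI2 _ j]
    rw [← integral_finsetSum _ fun i _ => integrable_finsetSum _ fun j _ => hI2 i j]
    refine integral_congr_ae ?_
    -- The only use of `w ∧ τ = 0`: it identifies the terms in which `f` is differentiated with a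
    -- derivative along `w`.
    filter_upwards [hwτ] with x hx
    rw [← multiPairing_covecWedge_curryLeft hx (fderiv ℝ f x) η,
      multiPairing_covecWedge_curryLeft_eq_sum]
    refine Finset.sum_congr rfl fun i _ => ?_
    rw [multiPairing_covecWedge, Finset.mul_sum]
    exact Finset.sum_congr rfl fun j _ => (mul_assoc _ _ _).symm
  rw [hlhs, hrhs]
  simp_rw [integral_add (hI1 _ _) (hI2 _ _), Finset.sum_add_distrib, Finset.mul_sum]
  rw [integral_finsetSum _ fun i _ => integrable_finsetSum _ fun j _ => hI1 i j]
  simp_rw [integral_finsetSum _ fun j _ => hI1 _ j]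

end Currents

/-! ### Global flow of a bounded Lipschitz field. -/

section Flow

open Filter Metric
open scoped Topology NNReal ContDiff Manifold

variable {E : Type*} [NormedAddCommGroup E] [NormedSpace ℝ E]

/-- `Φ` is a global flow of the vector field `w`. -/
structure IsGlobalFlow (Φ : ℝ → E → E) (w : E → E) : Prop where
  zero : ∀ x, Φ 0 x = x
  add : ∀ s t x, Φ s (Φ t x) = Φ (s + t) x
  hasDerivAt : ∀ t x, HasDerivAt (fun s => Φ s x) (w (Φ t x)) t

/-- The existence time is 1 at every starting point, so local curves extend to all times; uniqueness
gives the group law. -/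
theorem exists_isGlobalFlow [CompleteSpace E] {w : E → E} (hw : ContDiff ℝ 1 w) {K M : ℝ≥0}
    (hK : LipschitzWith K w) (hM : ∀ x, ‖w x‖ ≤ M) : ∃ Φ : ℝ → E → E, IsGlobalFlow Φ w := by
  have hloc (x : E) : ∃ γ : ℝ → E, γ 0 = x ∧
      IsMIntegralCurveOn (I := 𝓘(ℝ, E)) (M := E) γ w (Ioo (-1) 1) := by
    -- Speed at most `M` keeps the curve in the ball of radius `M` for unit time.
    have hp : IsPicardLindelof (fun _ => w) (⟨0, by norm_num, by norm_num⟩ : Icc (-1 : ℝ) 1)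
        x M 0 M K := ⟨fun _ _ => hK.lipschitzOnWith, fun _ _ => continuousOn_const,
          fun _ _ y _ => hM y, by simp⟩
    obtain ⟨γ, h0, hγ⟩ := hp.exists_eq_forall_mem_Icc_hasDerivWithinAt₀
    refine ⟨γ, h0, fun t ht => ?_⟩
    have := (hγ t (Ioo_subset_Icc_self ht)).mono Ioo_subset_Icc_self
    have h1 : HasFDerivWithinAt γ ((1 : ℝ →L[ℝ] ℝ).smulRight (w (γ t))) (Ioo (-1) 1) t :=
      this.hasFDerivWithinAt
    exact h1.hasMFDerivWithinAt
  have hglob (x : E) : ∃ γ : ℝ → E, γ 0 = x ∧ ∀ t, HasDerivAt γ (w (γ t)) t := by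
    obtain ⟨γ, h0, hγ⟩ := exists_isMIntegralCurve_of_isMIntegralCurveOn (I := 𝓘(ℝ, E)) (M := E)
      (v := w) (contMDiff_vectorSpace_iff_contDiff.2 hw) one_pos hloc x
    refine ⟨γ, h0, fun t => ?_⟩
    have h1 : HasFDerivAt γ ((1 : ℝ →L[ℝ] ℝ).smulRight (w (γ t))) t := (hγ t).hasFDerivAt
    simpa using h1.hasDerivAt
  choose γ h0 hγ using hglob
  refine ⟨fun t x => γ x t, h0, fun s t x => ?_, fun t x => hγ x t⟩
  have : γ (γ x t) = fun s => γ x (s + t) := by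
    refine ODE_solution_unique_univ (v := fun _ => w) (s := fun _ => univ) (t₀ := 0)
      (fun _ => hK.lipschitzOnWith) (fun s => ⟨hγ _ s, trivial⟩) (fun s => ⟨?_, trivial⟩) ?_
    · exact (hγ x (s + t)).comp_add_const s t
    · simp [h0]
  exact congrFun this s

namespace IsGlobalFlow

variable {Φ : ℝ → E → E} {w : E → E} {K M : ℝ≥0}

theorem dist_le_of_nonneg (h : IsGlobalFlow Φ w) (hK : LipschitzWith K w) {s : ℝ} (hs : 0 ≤ s)
    (x y : E) : dist (Φ s x) (Φ s y) ≤ dist x y * Real.exp (K * s) := by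
  have hd (z : E) : ∀ t ∈ Ico 0 s, HasDerivWithinAt (fun t => Φ t z) (w (Φ t z)) (Ici t) t :=
    fun t _ => (h.hasDerivAt t z).hasDerivWithinAt
  have hc (z : E) : ContinuousOn (fun t => Φ t z) (Icc 0 s) :=
    fun t _ => (h.hasDerivAt t z).continuousAt.continuousWithinAt
  have := dist_le_of_trajectories_ODE (v := fun _ => w) (fun _ => hK) (hc x) (hd x) (hc y) (hd y)
    (by simp only [h.zero]; exact le_rfl) s ⟨hs, le_rfl⟩
  simpa using this

theorem neg (h : IsGlobalFlow Φ w) : IsGlobalFlow (fun t => Φ (-t)) (fun x => -w x) where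
  zero x := by simp [h.zero]
  add s t x := by simp only [h.add, neg_add]
  hasDerivAt t x := by
    simpa [Function.comp_def] using (h.hasDerivAt (-t) x).scomp t (hasDerivAt_neg t)

/-- Grönwall for positive times, the reversed flow for negative ones. -/
theorem lipschitzWith_of_abs_le_one (h : IsGlobalFlow Φ w) (hK : LipschitzWith K w) {s : ℝ}
    (hs : |s| ≤ 1) : LipschitzWith (Real.exp K).toNNReal (Φ s) := by
  refine LipschitzWith.of_dist_le_mul fun x y => ?_
  rw [Real.coe_toNNReal _ (Real.exp_pos _).le]
  have h1 : dist (Φ s x) (Φ s y) ≤ dist x y * Real.exp (K * |s|) := by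
    rcases le_total 0 s with h0 | h0
    · rw [abs_of_nonneg h0]
      exact h.dist_le_of_nonneg hK h0 x y
    · rw [abs_of_nonpos h0]
      simpa using h.neg.dist_le_of_nonneg hK.neg (neg_nonneg.2 h0) x y
  refine h1.trans ?_
  rw [mul_comm]
  refine mul_le_mul_of_nonneg_right (Real.exp_le_exp.2 ?_) dist_nonneg
  exact mul_le_of_le_one_right K.coe_nonneg hs

theorem lipschitzWith_time (h : IsGlobalFlow Φ w) (hM : ∀ x, ‖w x‖ ≤ M) (x : E) :
    LipschitzWith M fun s => Φ s x :=
  lipschitzWith_of_nnnorm_deriv_le (fun t => (h.hasDerivAt t x).differentiableAt)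
    fun t => by rw [(h.hasDerivAt t x).deriv]; exact hM _

theorem lipschitzOnWith (h : IsGlobalFlow Φ w) (hK : LipschitzWith K w) (hM : ∀ x, ‖w x‖ ≤ M) :
    LipschitzOnWith (M + (Real.exp K).toNNReal) (fun p : ℝ × E => Φ p.1 p.2)
      (Icc (-1) 1 ×ˢ univ) := by
  refine LipschitzOnWith.of_dist_le_mul fun p hp q _ => ?_
  have h1 := (h.lipschitzWith_of_abs_le_one hK (abs_le.2 hp.1)).dist_le_mul p.2 q.2
  have h2 := (h.lipschitzWith_time hM q.2).dist_le_mul p.1 q.1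
  have h3 : dist p.1 q.1 ≤ dist p q := le_max_left _ _
  have h4 : dist p.2 q.2 ≤ dist p q := le_max_right _ _
  rw [NNReal.coe_add, add_mul]
  calc dist (Φ p.1 p.2) (Φ q.1 q.2)
      ≤ dist (Φ p.1 p.2) (Φ p.1 q.2) + dist (Φ p.1 q.2) (Φ q.1 q.2) := dist_triangle _ _ _
    _ ≤ (Real.exp K).toNNReal * dist p q + M * dist p q :=
      add_le_add (h1.trans (by gcongr)) (h2.trans (by gcongr))
    _ = _ := add_comm _ _

/-- The set swept out by `F` under the flow during the times in `I`. -/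
def sweep (Φ : ℝ → E → E) (I : Set ℝ) (F : Set E) : Set E :=
  (fun p : ℝ × E => Φ p.1 p.2) '' (I ×ˢ F)

theorem isCompact_sweep (h : IsGlobalFlow Φ w) (hK : LipschitzWith K w) (hM : ∀ x, ‖w x‖ ≤ M)
    {I : Set ℝ} (hI : IsCompact I) (hI1 : I ⊆ Icc (-1) 1) {F : Set E} (hF : IsCompact F) :
    IsCompact (sweep Φ I F) :=
  (hI.prod hF).image_of_continuousOn
    ((h.lipschitzOnWith hK hM).continuousOn.mono (prod_mono hI1 (subset_univ _)))

end IsGlobalFlow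

end Flow

/-! ### Hausdorff null sets and products with an interval. -/

section HausdorffNull

open Filter Metric
open scoped Topology NNReal ENNReal

variable {X : Type*} [MetricSpace X] [MeasurableSpace X] [BorelSpace X]

/-- The `r i` must be positive, even for sets of diameter zero, because they serve below as lengths
of time intervals. -/
theorem exists_cover_of_hausdorffMeasure_eq_zero {d : ℝ} (hd : 0 < d) {F : Set X}
    (hF : μH[d] F = 0) {ε : ℝ} (hε : 0 < ε) :
    ∃ (t : ℕ → Set X) (r : ℕ → ℝ), F ⊆ ⋃ i, t i ∧ (∀ i, 0 < r i ∧ r i ≤ ε) ∧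
      (∀ i, ediam (t i) ≤ ENNReal.ofReal (r i)) ∧
      ∑' i, ENNReal.ofReal (r i) ^ d ≤ 2 * ENNReal.ofReal ε := by
  have hε' : 0 < ENNReal.ofReal ε := ENNReal.ofReal_pos.2 hε
  rw [Measure.hausdorffMeasure_apply] at hF
  have h1 := le_of_eq hF
  have h2 := (iSup₂_le_iff.1 h1 (ENNReal.ofReal ε) hε').trans_lt hε'
  simp only [iInf_lt_iff] at h2
  obtain ⟨t, hFt, htd, hts⟩ := h2
  obtain ⟨δ, hδ, hδs⟩ := ENNReal.exists_pos_sum_of_countable hε'.ne' ℕ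
  have htop i : ediam (t i) ≠ ⊤ := ((htd i).trans_lt ENNReal.ofReal_lt_top).ne
  have htε i : (ediam (t i)).toReal ≤ ε := ENNReal.toReal_le_of_le_ofReal hε.le (htd i)
  -- Chosen so that `η i ^ d ≤ δ i`: enlarging the diameters adds at most `∑ δ i`.
  let η : ℕ → ℝ := fun i => min ε ((δ i : ℝ) ^ d⁻¹)
  have hη i : 0 < η i := lt_min hε (Real.rpow_pos_of_pos (hδ i) _)
  have hηδ i : ENNReal.ofReal (η i) ^ d ≤ δ i := by
    have h3 : η i ^ d ≤ δ i := by
      calc η i ^ d ≤ ((δ i : ℝ) ^ d⁻¹) ^ d :=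
            Real.rpow_le_rpow (hη i).le (min_le_right _ _) hd.le
        _ = δ i := by
            rw [← Real.rpow_mul (δ i).coe_nonneg, inv_mul_cancel₀ hd.ne', Real.rpow_one]
    rw [ENNReal.ofReal_rpow_of_pos (hη i)]
    simpa using ENNReal.ofReal_le_ofReal h3
  have hsup i : ediam (t i) ^ d ≤ ⨆ _ : (t i).Nonempty, ediam (t i) ^ d := by
    rcases (t i).eq_empty_or_nonempty with h | h
    · simp [h, ENNReal.zero_rpow_of_pos hd]
    · simp [h]
  refine ⟨t, fun i => max (ediam (t i)).toReal (η i), hFt, fun i => ⟨lt_max_of_lt_right (hη i),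
    max_le (htε i) (min_le_left _ _)⟩, fun i => ?_, ?_⟩
  · rw [← ENNReal.ofReal_toReal (htop i)]
    exact ENNReal.ofReal_le_ofReal (by simp)
  · calc ∑' i, ENNReal.ofReal (max (ediam (t i)).toReal (η i)) ^ d
        ≤ ∑' i, ((⨆ _ : (t i).Nonempty, ediam (t i) ^ d) + δ i) := by
          refine ENNReal.tsum_le_tsum fun i => ?_
          rcases max_choice (ediam (t i)).toReal (η i) with h | h
          · rw [h, ENNReal.ofReal_toReal (htop i)]
            exact (hsup i).trans le_self_add
          · rw [h]
            exact (hηδ i).trans le_add_self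
      _ = (∑' i, ⨆ _ : (t i).Nonempty, ediam (t i) ^ d) + ∑' i, (δ i : ℝ≥0∞) := ENNReal.tsum_add
      _ ≤ 2 * ENNReal.ofReal ε := by
          rw [two_mul]
          exact add_le_add hts.le hδs.le

/-- Above each covering set of size `r`, about `2 / r` boxes of side `r` cover the product. Their
cost, about `(2 / r) r ^ (d + 1)`, is comparable to `r ^ d`. -/
theorem hausdorffMeasure_Icc_prod_eq_zero [SecondCountableTopology X] {d : ℝ} (hd : 0 ≤ d)
    {F : Set X} (hF : μH[d] F = 0) : μH[d + 1] (Icc (-1 : ℝ) 1 ×ˢ F) = 0 := by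
  -- In dimension 0 the measure is at least 1 on nonempty sets, so a null set is empty.
  rcases hd.eq_or_lt with rfl | hd
  · have : F = ∅ := by
      by_contra h
      have := Measure.one_le_hausdorffMeasure_zero_of_nonempty (nonempty_iff_ne_empty.2 h)
      rw [hF] at this
      simp at this
    simp [this]
  let ε : ℕ → ℝ := fun m => 1 / ((m : ℝ) + 1)
  have hε m : 0 < ε m := by positivity
  have hε1 m : ε m ≤ 1 := by
    rw [div_le_one (by positivity)]
    simp
  have hε0 : Tendsto (fun m => ENNReal.ofReal (ε m)) atTop (𝓝 0) := by
    simpa [ε] using ENNReal.tendsto_ofReal (tendsto_one_div_add_atTop_nhds_zero_nat (𝕜 := ℝ))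
  choose t r hFt hr htr hs using fun m =>
    exists_cover_of_hausdorffMeasure_eq_zero hd hF (hε m)
  -- The extra interval catches the right endpoint when `2 / r` is an integer.
  let N : ℕ → ℕ → ℕ := fun m i => ⌈2 / r m i⌉₊ + 1
  let J : ℕ → ℕ → ℕ → Set ℝ := fun m i j =>
    Icc (-1 + j * r m i) (-1 + j * r m i + r m i)
  let U : ∀ m : ℕ, (Σ i, Fin (N m i)) → Set (ℝ × X) := fun m p => J m p.1 p.2 ×ˢ t m p.1
  have hU m p : ediam (U m p) ≤ ENNReal.ofReal (r m p.1) := by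
    refine ediam_le fun x hx y hy => max_le ?_ ?_
    · rw [edist_dist]
      refine ENNReal.ofReal_le_ofReal ((Real.dist_le_of_mem_Icc hx.1 hy.1).trans (by simp))
    · exact (edist_le_ediam_of_mem hx.2 hy.2).trans (htr m p.1)
  have hN m i : (N m i : ℝ≥0∞) * ENNReal.ofReal (r m i) ^ (d + 1) ≤
      4 * ENNReal.ofReal (r m i) ^ d := by
    have h0 := (hr m i).1
    have h1 : (N m i : ℝ) * r m i ≤ 4 := by
      have := (Nat.ceil_lt_add_one (div_pos two_pos h0).le).le
      calc (N m i : ℝ) * r m i ≤ (2 / r m i + 2) * r m i := by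
            refine mul_le_mul_of_nonneg_right ?_ h0.le
            push_cast [N]
            linarith
        _ = 2 + 2 * r m i := by field_simp
        _ ≤ 4 := by linarith [(hr m i).2.trans (hε1 m)]
    rw [ENNReal.rpow_add _ _ (ENNReal.ofReal_pos.2 h0).ne' ENNReal.ofReal_ne_top,
      ENNReal.rpow_one, mul_comm (_ ^ d), ← mul_assoc]
    refine mul_le_mul_left ?_ _
    rw [← ENNReal.ofReal_natCast, ← ENNReal.ofReal_mul (Nat.cast_nonneg _)]
    simpa using ENNReal.ofReal_le_ofReal h1
  have hsum m : ∑' p, ediam (U m p) ^ (d + 1) ≤ 4 * (2 * ENNReal.ofReal (ε m)) := by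
    calc ∑' p, ediam (U m p) ^ (d + 1)
        ≤ ∑' p : Σ i, Fin (N m i), ENNReal.ofReal (r m p.1) ^ (d + 1) :=
          ENNReal.tsum_le_tsum fun p => ENNReal.rpow_le_rpow (hU m p) (by positivity)
      _ = ∑' i, (N m i : ℝ≥0∞) * ENNReal.ofReal (r m i) ^ (d + 1) := by
          rw [ENNReal.tsum_sigma']
          simp [tsum_fintype]
      _ ≤ ∑' i, 4 * ENNReal.ofReal (r m i) ^ d := ENNReal.tsum_le_tsum fun i => hN m i
      _ ≤ _ := by
          rw [ENNReal.tsum_mul_left]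
          exact mul_le_mul_right (hs m) _
  have hlim : Tendsto (fun m => 4 * (2 * ENNReal.ofReal (ε m))) atTop (𝓝 0) := by
    have h1 := ENNReal.Tendsto.const_mul (a := 2) hε0 (Or.inr (by simp))
    have h2 := ENNReal.Tendsto.const_mul (a := 4) h1 (Or.inr (by simp))
    simpa using h2
  refine le_antisymm ?_ zero_le
  refine (Measure.hausdorffMeasure_le_liminf_tsum (d + 1) _ (fun m => ENNReal.ofReal (ε m)) hε0 U
    (.of_forall fun m p => (hU m p).trans (ENNReal.ofReal_le_ofReal (hr m p.1).2))
    (.of_forall fun m x hx => ?_)).trans ?_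
  · obtain ⟨i, hi⟩ := mem_iUnion.1 (hFt m hx.2)
    have h0 := (hr m i).1
    have hx1 : 0 ≤ (x.1 + 1) / r m i := div_nonneg (by linarith [hx.1.1]) h0.le
    have hj : ⌊(x.1 + 1) / r m i⌋₊ < N m i := by
      refine Nat.lt_succ_of_le ((Nat.floor_le_ceil _).trans (Nat.ceil_mono ?_))
      exact div_le_div_of_nonneg_right (by linarith [hx.1.2]) h0.le
    refine mem_iUnion.2 ⟨⟨i, ⟨_, hj⟩⟩, ⟨⟨?_, ?_⟩, hi⟩⟩
    · have := (le_div_iff₀ h0).1 (Nat.floor_le hx1)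
      simp only
      linarith
    · have := (div_lt_iff₀ h0).1 (Nat.lt_floor_add_one ((x.1 + 1) / r m i))
      simp only
      linarith
  · exact (liminf_le_liminf (.of_forall hsum)).trans hlim.liminf_eq.le

end HausdorffNull

/-! ### Averages along trajectories. -/

section FlowAverage

open Filter Metric
open scoped Topology NNReal ContDiff

/-- The curve and its tangent line differ by `o(h)`, hence so do the values of the Lipschitz
function `g`, which need not be differentiable. -/
theorem HasDerivAt.lineDeriv_of_curve {E : Type*} [NormedAddCommGroup E] [NormedSpace ℝ E]
    {g : E → ℝ} {L : ℝ≥0} (hg : LipschitzWith L g) {γ : ℝ → E} {u : E} (hγ : HasDerivAt γ u 0)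
    {D : ℝ} (hD : HasDerivAt (fun h => g (γ h)) D 0) :
    HasDerivAt (fun h : ℝ => g (γ 0 + h • u)) D 0 := by
  have h1 : HasDerivAt (fun h : ℝ => g (γ 0 + h • u) - g (γ h)) 0 0 := by
    rw [hasDerivAt_iff_isLittleO] at hγ ⊢
    refine Asymptotics.IsBigO.trans_isLittleO (Asymptotics.IsBigO.of_bound L ?_) hγ
    refine .of_forall fun h => ?_
    have := hg.dist_le_mul (γ 0 + h • u) (γ h)
    rw [dist_comm (γ 0 + h • u), dist_eq_norm, dist_eq_norm] at this
    simpa [sub_sub] using this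
  simpa using h1.fun_add hD

namespace IsGlobalFlow

/-- The integral of `f` along the trajectory issued from `x` during the time `δ`. -/
def flowIntegral {E : Type*} (Φ : ℝ → E → E) (δ : ℝ) (f : E → ℝ) (x : E) : ℝ :=
  ∫ s in (0 : ℝ)..δ, f (Φ s x)

theorem abs_flowIntegral_le {E : Type*} {Φ : ℝ → E → E} {δ : ℝ} (h0 : 0 ≤ δ) {f : E → ℝ} {C : ℝ} (hC : ∀ x, |f x| ≤ C)
    (x : E) : |flowIntegral Φ δ f x| ≤ C * δ := by
  have := intervalIntegral.norm_integral_le_of_norm_le_const (a := (0 : ℝ)) (b := δ)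
    (f := fun s => f (Φ s x)) (C := C) fun s _ => hC _
  rwa [sub_zero, abs_of_nonneg h0] at this

section ApproxIndicator

variable {E : Type*} [PseudoMetricSpace E]

/-- The Lipschitz functions decreasing to the indicator function of a closed set. -/
def approxIndicator (A : Set E) (j : ℕ) (x : E) : ℝ :=
  thickenedIndicator (δ := 1 / ((j : ℝ) + 1)) (by positivity) A x

theorem lipschitzWith_approxIndicator (A : Set E) (j : ℕ) :
    ∃ L : ℝ≥0, LipschitzWith L (approxIndicator A j) :=
  ⟨_, LipschitzWith.subtype_val _ |>.comp (lipschitzWith_thickenedIndicator _ A)⟩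

theorem abs_approxIndicator_le (A : Set E) (j : ℕ) (x : E) : |approxIndicator A j x| ≤ 1 := by
  rw [approxIndicator, NNReal.abs_eq]
  exact_mod_cast thickenedIndicator_le_one _ A x

theorem tendsto_approxIndicator {A : Set E} (hA : IsClosed A) (x : E) :
    Tendsto (fun j => approxIndicator A j x) atTop (𝓝 (A.indicator 1 x)) := by
  have := tendsto_pi_nhds.1 (thickenedIndicator_tendsto_indicator_closure
    (δseq := fun j : ℕ => 1 / ((j : ℝ) + 1)) (fun j => by positivity)
    tendsto_one_div_add_atTop_nhds_zero_nat A) x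
  rw [hA.closure_eq] at this
  have h2 := (NNReal.continuous_coe.tendsto _).comp this
  have e : (A.indicator 1 x : ℝ) = (A.indicator (fun _ => 1) x : ℝ≥0) := by
    by_cases hx : x ∈ A <;> simp [hx]
  rw [e]
  exact h2

end ApproxIndicator

variable {E : Type*} [NormedAddCommGroup E] [NormedSpace ℝ E]
  {Φ : ℝ → E → E} {w : E → E} {K M : ℝ≥0}

theorem continuous_time (h : IsGlobalFlow Φ w) (x : E) : Continuous fun s => Φ s x :=
  continuous_iff_continuousAt.2 fun t => (h.hasDerivAt t x).continuousAt

theorem lipschitzWith_flowIntegral (h : IsGlobalFlow Φ w) (hK : LipschitzWith K w) {δ : ℝ}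
    (h0 : 0 ≤ δ) (h1 : δ ≤ 1) {f : E → ℝ} {L : ℝ≥0} (hf : LipschitzWith L f) :
    LipschitzWith (L * (Real.exp K).toNNReal) (flowIntegral Φ δ f) := by
  refine LipschitzWith.of_dist_le_mul fun x y => ?_
  have hi (z : E) : IntervalIntegrable (fun s => f (Φ s z)) volume 0 δ :=
    (hf.continuous.comp (h.continuous_time z)).intervalIntegrable _ _
  rw [Real.dist_eq, flowIntegral, flowIntegral, ← intervalIntegral.integral_sub (hi x) (hi y)]
  have := intervalIntegral.norm_integral_le_of_norm_le_const (a := (0 : ℝ)) (b := δ)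
    (f := fun s => f (Φ s x) - f (Φ s y)) (C := (L * (Real.exp K).toNNReal : ℝ≥0) * dist x y)
    fun s hs => by
      rw [uIoc_of_le h0] at hs
      rw [← dist_eq_norm]
      exact (hf.comp (h.lipschitzWith_of_abs_le_one hK
        (abs_le.2 ⟨by linarith [hs.1], hs.2.trans h1⟩))).dist_le_mul x y
  refine this.trans (mul_le_of_le_one_right (by positivity) ?_)
  rwa [sub_zero, abs_of_nonneg h0]

/-- Along the trajectory the function is the integral over the moving window `[t, δ + t]`, so the
fundamental theorem of calculus applies; `HasDerivAt.lineDeriv_of_curve` then replaces the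
trajectory by its tangent. -/
theorem hasDerivAt_flowIntegral (h : IsGlobalFlow Φ w) (hK : LipschitzWith K w) {δ : ℝ}
    (h0 : 0 ≤ δ) (h1 : δ ≤ 1) {f : E → ℝ} {L : ℝ≥0} (hf : LipschitzWith L f) (x : E) :
    HasDerivAt (fun t : ℝ => flowIntegral Φ δ f (x + t • w x)) (f (Φ δ x) - f x) 0 := by
  have hc : Continuous fun s => f (Φ s x) := hf.continuous.comp (h.continuous_time x)
  have hcurve : HasDerivAt (fun t => flowIntegral Φ δ f (Φ t x)) (f (Φ δ x) - f x) 0 := by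
    have he (t : ℝ) : flowIntegral Φ δ f (Φ t x) =
        (∫ s in (0 : ℝ)..(δ + t), f (Φ s x)) - ∫ s in (0 : ℝ)..t, f (Φ s x) := by
      rw [intervalIntegral.integral_interval_sub_left (hc.intervalIntegrable _ _)
        (hc.intervalIntegrable _ _), flowIntegral]
      simp_rw [h.add]
      rw [intervalIntegral.integral_comp_add_right (fun s => f (Φ s x)), zero_add]
    simp_rw [he]
    have hi (t : ℝ) := intervalIntegral.integral_hasDerivAt_right (hc.intervalIntegrable 0 t)
      (hc.stronglyMeasurableAtFilter _ _) hc.continuousAt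
    have h2 := (hi (δ + 0)).comp_const_add δ 0
    have h3 := h2.fun_sub (hi 0)
    rwa [add_zero, h.zero] at h3
  have := HasDerivAt.lineDeriv_of_curve (h.lipschitzWith_flowIntegral hK h0 h1 hf)
    (h.hasDerivAt 0 x) hcurve
  simpa only [h.zero] using this

theorem tendsto_flowIntegral (h : IsGlobalFlow Φ w) {A : Set E} (hA : IsClosed A) (δ : ℝ) (x : E) :
    Tendsto (fun j => flowIntegral Φ δ (approxIndicator A j) x) atTop
      (𝓝 (flowIntegral Φ δ (A.indicator 1) x)) := by
  refine intervalIntegral.tendsto_integral_filter_of_dominated_convergence (fun _ => 1)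
    (.of_forall fun j => ?_) (.of_forall fun j => .of_forall fun s _ => ?_) (by simp)
    (.of_forall fun s _ => tendsto_approxIndicator hA _)
  · obtain ⟨L, hL⟩ := lipschitzWith_approxIndicator A j
    exact (hL.continuous.comp (h.continuous_time x)).aestronglyMeasurable
  · exact abs_approxIndicator_le A j _

theorem measurable_flowIntegral_indicator [MeasurableSpace E] [BorelSpace E]
    (h : IsGlobalFlow Φ w) (hK : LipschitzWith K w) {δ : ℝ} (h0 : 0 ≤ δ) (h1 : δ ≤ 1) {A : Set E}
    (hA : IsClosed A) : Measurable (flowIntegral Φ δ (A.indicator 1)) := by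
  refine measurable_of_tendsto_metrizable (f := fun j => flowIntegral Φ δ (approxIndicator A j))
    (fun j => ?_) (tendsto_pi_nhds.2 fun x => h.tendsto_flowIntegral hA δ x)
  obtain ⟨L, hL⟩ := lipschitzWith_approxIndicator A j
  exact (h.lipschitzWith_flowIntegral hK h0 h1 hL).continuous.measurable

end IsGlobalFlow

end FlowAverage

/-! ### Vanishing of `b μ'` on sets with null sweep. -/

section LieIdentity

open Filter Metric IsGlobalFlow
open scoped Topology NNReal ContDiff

variable {E : Type*} [NormedAddCommGroup E] [InnerProductSpace ℝ E] [FiniteDimensional ℝ E]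
  [MeasurableSpace E] [BorelSpace E] {X : Type*} [TopologicalSpace X] [MeasurableSpace X]
  [OpensMeasurableSpace X]

/-- The distributional identity `b μ' = c μ - div (w a μ)`, tested against `C¹` functions. -/
structure LieIdentity (p : X → E) (w : E → E) (μ μ' : Measure X) (a b c : X → ℝ) : Prop where
  continuous : Continuous p
  integrable_a : Integrable a μ
  integrable_b : Integrable b μ'
  integrable_c : Integrable c μ
  identity : ∀ f : E → ℝ, ContDiff ℝ 1 f → ∫ x, f (p x) * b x ∂μ' =
    ∫ x, f (p x) * c x ∂μ + ∫ x, fderiv ℝ f (p x) (w (p x)) * a x ∂μ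

namespace LieIdentity

variable {p : X → E} {w : E → E} {μ μ' : Measure X} {a b c : X → ℝ} {K M : ℝ≥0}
  {Φ : ℝ → E → E}

theorem identity_flowIntegral (H : LieIdentity p w μ μ' a b c) (hK : LipschitzWith K w)
    (hM : ∀ x, ‖w x‖ ≤ M) (hΦ : IsGlobalFlow Φ w) {δ : ℝ} (h0 : 0 ≤ δ) (h1 : δ ≤ 1) {f : E → ℝ}
    {L : ℝ≥0} {C : ℝ} (hf : LipschitzWith L f) (hC : ∀ x, |f x| ≤ C) :
    ∫ x, flowIntegral Φ δ f (p x) * b x ∂μ' = ∫ x, flowIntegral Φ δ f (p x) * c x ∂μ +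
      ∫ x, (f (Φ δ (p x)) - f (p x)) * a x ∂μ := by
  have hδ : LipschitzWith (Real.exp K).toNNReal (Φ δ) :=
    hΦ.lipschitzWith_of_abs_le_one hK (by rwa [abs_of_nonneg h0])
  have := integral_identity_of_mollify (ι := Unit) (μ := μ) (μ' := μ') (p := p) H.continuous
    H.integrable_b H.integrable_c (fun _ => H.integrable_a) (fun _ => hK) (fun _ => hM)
    (hΦ.lipschitzWith_flowIntegral hK h0 h1 hf) (abs_flowIntegral_le h0 hC)
    (D := fun _ x => f (Φ δ x) - f x)
    (fun _ => (hf.continuous.comp hδ.continuous).sub hf.continuous)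
    (fun _ => hΦ.hasDerivAt_flowIntegral hK h0 h1 hf) (.of_forall fun m => ?_)
  · simpa using this
  · rw [H.identity _ ((contDiff_mollify m
      (hΦ.lipschitzWith_flowIntegral hK h0 h1 hf).continuous).of_le (by simp))]
    simp

/-- In the limit of the Lipschitz approximations, the terms in `μ` involve only points whose orbit
meets `A` during `[0, δ]`, and these form a null set. -/
theorem integral_flowIntegral_indicator_eq_zero (H : LieIdentity p w μ μ' a b c)
    (hK : LipschitzWith K w) (hM : ∀ x, ‖w x‖ ≤ M) (hΦ : IsGlobalFlow Φ w) {δ : ℝ} (h0 : 0 ≤ δ)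
    (h1 : δ ≤ 1) {A : Set E} (hA : IsClosed A)
    (hnull : ∀ᵐ x ∂μ, ∀ s ∈ Icc 0 δ, Φ s (p x) ∉ A) :
    ∫ x, flowIntegral Φ δ (A.indicator 1) (p x) * b x ∂μ' = 0 := by
  choose L hL using lipschitzWith_approxIndicator A
  have hδ : LipschitzWith (Real.exp K).toNNReal (Φ δ) :=
    hΦ.lipschitzWith_of_abs_le_one hK (by rwa [abs_of_nonneg h0])
  have key {ν : Measure X} {g : X → ℝ} (hg : Integrable g ν) :
      Tendsto (fun j => ∫ x, flowIntegral Φ δ (approxIndicator A j) (p x) * g x ∂ν) atTop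
        (𝓝 (∫ x, flowIntegral Φ δ (A.indicator 1) (p x) * g x ∂ν)) := by
    refine tendsto_integral_of_dominated_convergence (fun x => 1 * δ * ‖g x‖) (fun j => ?_)
      (hg.norm.const_mul _) (fun j => .of_forall fun x => ?_) (.of_forall fun x => ?_)
    · exact ((hΦ.lipschitzWith_flowIntegral hK h0 h1 (hL j)).continuous.comp
        H.continuous).aestronglyMeasurable.mul hg.aestronglyMeasurable
    · rw [norm_mul]
      exact mul_le_mul_of_nonneg_right (abs_flowIntegral_le h0 (abs_approxIndicator_le A j) _)
        (norm_nonneg _)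
    · exact (hΦ.tendsto_flowIntegral hA δ _).mul_const _
  have key2 : Tendsto (fun j => ∫ x, (approxIndicator A j (Φ δ (p x)) - approxIndicator A j (p x))
      * a x ∂μ) atTop
      (𝓝 (∫ x, ((A.indicator 1 (Φ δ (p x)) : ℝ) - A.indicator 1 (p x)) * a x ∂μ)) := by
    refine tendsto_integral_of_dominated_convergence (fun x => 2 * ‖a x‖) (fun j => ?_)
      (H.integrable_a.norm.const_mul _) (fun j => .of_forall fun x => ?_) (.of_forall fun x => ?_)
    · have hc := (hL j).continuous
      exact (((hc.comp (hδ.continuous.comp H.continuous)).sub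
        (hc.comp H.continuous)).aestronglyMeasurable).mul H.integrable_a.aestronglyMeasurable
    · rw [norm_mul]
      refine mul_le_mul_of_nonneg_right ((norm_sub_le _ _).trans ?_) (norm_nonneg _)
      have h2 := abs_approxIndicator_le A j (Φ δ (p x))
      have h3 := abs_approxIndicator_le A j (p x)
      simp only [Real.norm_eq_abs]
      linarith
    · exact ((tendsto_approxIndicator hA _).sub (tendsto_approxIndicator hA _)).mul_const _
  have hlim := (key H.integrable_c).add key2
  have hzero1 : ∫ x, flowIntegral Φ δ (A.indicator 1) (p x) * c x ∂μ = 0 := by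
    refine integral_eq_zero_of_ae ?_
    filter_upwards [hnull] with x hx
    have : flowIntegral Φ δ (A.indicator 1) (p x) = 0 := by
      refine intervalIntegral.integral_zero_ae (.of_forall fun s hs => ?_)
      rw [uIoc_of_le h0] at hs
      exact indicator_of_notMem (hx s (Ioc_subset_Icc_self hs)) _
    simp [this]
  have hzero2 : ∫ x, ((A.indicator 1 (Φ δ (p x)) : ℝ) - A.indicator 1 (p x)) * a x ∂μ = 0 := by
    refine integral_eq_zero_of_ae ?_
    filter_upwards [hnull] with x hx
    have h2 := hx 0 ⟨le_rfl, h0⟩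
    rw [hΦ.zero] at h2
    simp [hx δ ⟨h0, le_rfl⟩, h2]
  rw [hzero1, hzero2, add_zero] at hlim
  refine tendsto_nhds_unique (key H.integrable_b) (hlim.congr fun j => ?_)
  exact (H.identity_flowIntegral hK hM hΦ h0 h1 (hL j) (abs_approxIndicator_le A j)).symm

theorem setIntegral_eq_zero (H : LieIdentity p w μ μ' a b c) (hK : LipschitzWith K w)
    (hM : ∀ x, ‖w x‖ ≤ M) (hΦ : IsGlobalFlow Φ w) {F : Set E} (hF : IsCompact F)
    (hnull : μ (p ⁻¹' sweep Φ (Icc (-1) 1) F) = 0) : ∫ x in p ⁻¹' F, b x ∂μ' = 0 := by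
  let δ : ℕ → ℝ := fun m => 1 / ((m : ℝ) + 1)
  have hδ m : 0 < δ m := by positivity
  have hδ1 m : δ m ≤ 1 := by
    rw [div_le_one (by positivity)]
    simp
  have hδ0 : Tendsto δ atTop (𝓝 0) := tendsto_one_div_add_atTop_nhds_zero_nat
  let A : ℕ → Set E := fun m => sweep Φ (Icc 0 (δ m)) F
  have hA m : IsClosed (A m) := (hΦ.isCompact_sweep hK hM isCompact_Icc
    (Icc_subset_Icc (by norm_num) (hδ1 m)) hF).isClosed
  -- A point whose orbit reaches the sweep within time `δ m` lies on the orbit of a point of `F`, at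
  -- time at most `δ m` in absolute value.
  have hback {m : ℕ} {s : ℝ} {x : E} (hs : s ∈ Icc 0 (δ m)) (hx : Φ s x ∈ A m) :
      ∃ r ∈ Icc (-δ m) (δ m), ∃ y ∈ F, Φ r y = x := by
    obtain ⟨⟨r, y⟩, ⟨hr, hy⟩, hxy⟩ := hx
    refine ⟨-s + r, ⟨by linarith [hs.2, hr.1], by linarith [hs.1, hr.2]⟩, y, hy, ?_⟩
    rw [← hΦ.add]
    simp only at hxy
    rw [hxy, hΦ.add, neg_add_cancel, hΦ.zero]
  -- The fraction of the time `[0, δ m]` spent in `A m`. It is 1 on `F`, whose orbits stay in `A m`,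
  -- and tends to 0 off `F` because the speed is bounded.
  let θ : ℕ → E → ℝ := fun m x => (δ m)⁻¹ * flowIntegral Φ (δ m) ((A m).indicator 1) x
  have hθ m : ∫ x, θ m (p x) * b x ∂μ' = 0 := by
    simp_rw [θ, mul_assoc]
    rw [integral_const_mul, H.integral_flowIntegral_indicator_eq_zero hK hM hΦ (hδ m).le (hδ1 m)
      (hA m) ?_, mul_zero]
    refine measure_mono_null (fun x hx => ?_) hnull
    simp only [mem_compl_iff, mem_ofPred_eq, not_forall, not_not] at hx
    obtain ⟨s, hs, hsx⟩ := hx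
    obtain ⟨r, hr, y, hy, hxy⟩ := hback hs hsx
    exact ⟨(r, y), ⟨⟨by linarith [hr.1, hδ1 m], by linarith [hr.2, hδ1 m]⟩, hy⟩, hxy⟩
  have hθ1 m x : |θ m x| ≤ 1 := by
    have := abs_flowIntegral_le (Φ := Φ) (hδ m).le (f := (A m).indicator 1) (C := 1)
      (fun y => by by_cases hy : y ∈ A m <;> simp [hy]) x
    rw [abs_mul, abs_inv, abs_of_pos (hδ m), inv_mul_le_iff₀ (hδ m)]
    linarith
  have hlim x : Tendsto (fun m => θ m x) atTop (𝓝 (F.indicator 1 x)) := by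
    by_cases hx : x ∈ F
    · refine tendsto_const_nhds.congr fun m => ?_
      have : flowIntegral Φ (δ m) ((A m).indicator 1) x = ∫ _ in (0 : ℝ)..(δ m), (1 : ℝ) := by
        refine intervalIntegral.integral_congr fun s hs => ?_
        rw [uIcc_of_le (hδ m).le] at hs
        exact indicator_of_mem (show Φ s x ∈ A m from ⟨(s, x), ⟨hs, hx⟩, rfl⟩) _
      simp [θ, this, hx, (hδ m).ne']
    · obtain ⟨ε, hε, hball⟩ := isOpen_iff.1 hF.isClosed.isOpen_compl x hx
      have hM0 : Tendsto (fun m => M * δ m) atTop (𝓝 0) := by simpa using hδ0.const_mul (M : ℝ)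
      refine tendsto_const_nhds.congr' ?_
      filter_upwards [hM0.eventually (gt_mem_nhds hε)] with m hm
      have : flowIntegral Φ (δ m) ((A m).indicator 1) x = 0 := by
        refine intervalIntegral.integral_zero_ae (.of_forall fun s hs => ?_)
        rw [uIoc_of_le (hδ m).le] at hs
        refine indicator_of_notMem (fun hsx => ?_) _
        obtain ⟨r, hr, y, hy, hxy⟩ := hback (Ioc_subset_Icc_self hs) hsx
        refine hball ?_ hy
        have h3 := (hΦ.lipschitzWith_time hM y).dist_le_mul 0 r
        simp only [hΦ.zero, hxy, dist_zero_left, Real.norm_eq_abs] at h3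
        rw [mem_ball]
        exact (h3.trans (mul_le_mul_of_nonneg_left (abs_le.2 hr) M.coe_nonneg)).trans_lt hm
      simp [θ, this, hx]
  have hmain : Tendsto (fun m => ∫ x, θ m (p x) * b x ∂μ') atTop
      (𝓝 (∫ x, (F.indicator 1 (p x) : ℝ) * b x ∂μ')) := by
    refine tendsto_integral_of_dominated_convergence (fun x => ‖b x‖) (fun m => ?_)
      H.integrable_b.norm (fun m => .of_forall fun x => ?_) (.of_forall fun x => ?_)
    · refine AEStronglyMeasurable.mul ?_ H.integrable_b.aestronglyMeasurable
      exact (((hΦ.measurable_flowIntegral_indicator hK (hδ m).le (hδ1 m) (hA m)).const_mul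
        _).comp H.continuous.measurable).aestronglyMeasurable
    · rw [norm_mul]
      exact mul_le_of_le_one_left (norm_nonneg _) (hθ1 m _)
    · exact (hlim _).mul_const _
  simp_rw [hθ] at hmain
  rw [← integral_indicator (H.continuous.measurable hF.isClosed.measurableSet),
    tendsto_nhds_unique tendsto_const_nhds hmain]
  refine integral_congr_ae (.of_forall fun x => ?_)
  by_cases hx : p x ∈ F <;> simp [hx, indicator]

end LieIdentity

end LieIdentity

/-! ### Cutoff, regularity and conclusion. -/

section Main

open Filter Metric IsGlobalFlow
open scoped Topology NNReal ContDiff Manifold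

theorem contDiff_of_tsupport_subset_isOpen {E F : Type*} [NormedAddCommGroup E] [NormedSpace ℝ E]
    [NormedAddCommGroup F] [NormedSpace ℝ F] {U : Set E} (hU : IsOpen U) {f : E → F}
    {m : WithTop ℕ∞} (hf : ContDiffOn ℝ m f U) (hs : tsupport f ⊆ U) : ContDiff ℝ m f := by
  refine contDiff_iff_contDiffAt.2 fun x => ?_
  by_cases hx : x ∈ tsupport f
  · exact hf.contDiffAt (hU.mem_nhds (hs hx))
  · exact contDiffAt_const.congr_of_eventuallyEq (notMem_tsupport_iff_eventuallyEq.1 hx)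

theorem exists_contDiff_cutoff {n : ℕ} {F U : Set (RSpace n)} (hF : IsCompact F) (hU : IsOpen U)
    (hFU : F ⊆ U) : ∃ χ : RSpace n → ℝ, ContDiff ℝ ∞ χ ∧ HasCompactSupport χ ∧ tsupport χ ⊆ U ∧
      ∀ x ∈ F, χ x = 1 := by
  obtain ⟨δ, hδ, hδU⟩ := hF.exists_cthickening_subset_open hU hFU
  obtain ⟨χ, hχ, -, hχs, hχ1⟩ := exists_contMDiff_support_eq_eq_one_iff (n := ⊤) 𝓘(ℝ, RSpace n)
    (isOpen_thickening (δ := δ) (E := F)) hF.isClosed (self_subset_thickening hδ F)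
  have hs : tsupport χ ⊆ cthickening δ F := by
    rw [tsupport, hχs]
    exact closure_thickening_subset_cthickening _ _
  exact ⟨χ, hχ.contDiff, hF.cthickening.of_isClosed_subset (isClosed_tsupport _) hs,
    hs.trans hδU, fun x hx => (hχ1 x).1 hx⟩

/-- Otherwise a compact subset of positive measure would carry a positive function with zero
integral. -/
theorem measure_inter_pos_eq_zero_of_isCompact {X : Type*} [TopologicalSpace X] [T2Space X]
    [MeasurableSpace X] [BorelSpace X] {ν : Measure X} [ν.InnerRegular] {b : X → ℝ}
    (hb : AEStronglyMeasurable b ν) {A : Set X} (hA : MeasurableSet A)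
    (h : ∀ F ⊆ A, IsCompact F → IntegrableOn b F ν ∧ ∫ x in F, b x ∂ν = 0) :
    ν (A ∩ {x | 0 < b x}) = 0 := by
  -- A measurable representative makes the positivity set Borel, as inner regularity requires.
  set b' := hb.mk b
  have hbb' : b =ᵐ[ν] b' := hb.ae_eq_mk
  have hb' : Measurable b' := hb.stronglyMeasurable_mk.measurable
  have hS : MeasurableSet (A ∩ {x | 0 < b' x}) := hA.inter (measurableSet_lt measurable_const hb')
  have hS0 : ν (A ∩ {x | 0 < b' x}) = 0 := by
    by_contra hne
    obtain ⟨F, hFS, hF, hFpos⟩ := hS.exists_lt_isCompact (pos_iff_ne_zero.2 hne)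
    obtain ⟨hi, h0⟩ := h F (hFS.trans inter_subset_left) hF
    have hpos : ∀ᵐ x ∂ν.restrict F, 0 < b x := by
      filter_upwards [ae_restrict_of_ae hbb', ae_restrict_mem hF.measurableSet] with x hx hxF
      rw [hx]
      exact (hFS hxF).2
    have hz := (integral_eq_zero_iff_of_nonneg_ae (hpos.mono fun x hx => hx.le) hi).1 h0
    have : ∀ᵐ x ∂ν.restrict F, False := by
      filter_upwards [hpos, hz] with x h1 h2
      exact h1.ne' h2
    rw [eventually_false_iff_eq_bot, ae_eq_bot, Measure.restrict_eq_zero] at this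
    exact hFpos.ne' this
  refine measure_mono_null_ae ?_ hS0
  filter_upwards [hbb'] with x hx hxS
  exact ⟨hxS.1, by simpa [← hx] using hxS.2⟩

variable {n k : ℕ} {Ω : Opens (RSpace n)}

/-- The sweep is a Lipschitz image of the product of `[-1, 1]` and `F`. -/
theorem hausdorffMeasure_sweep_eq_zero {Φ : ℝ → RSpace n → RSpace n} {w : RSpace n → RSpace n}
    {K M : ℝ≥0} (hΦ : IsGlobalFlow Φ w) (hK : LipschitzWith K w) (hM : ∀ x, ‖w x‖ ≤ M) {d : ℝ}
    (hd : 0 ≤ d) {F : Set (RSpace n)} (hF : μH[d] F = 0) :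
    μH[d + 1] (sweep Φ (Icc (-1) 1) F) = 0 := by
  have h := ((hΦ.lipschitzOnWith hK hM).mono
    (prod_mono_right (subset_univ F))).hausdorffMeasure_image_le (d := d + 1) (by positivity)
  rw [hausdorffMeasure_Icc_prod_eq_zero hd hF, mul_zero] at h
  exact le_antisymm h zero_le

theorem hausdorffMeasure_coe_preimage_eq_zero {d : ℝ} (hd : 0 ≤ d) {S : Set (RSpace n)}
    (hS : μH[d] S = 0) : μH[d] ((↑) ⁻¹' S : Set Ω) = 0 := by
  rw [← isometry_subtype_coe.hausdorffMeasure_image (Or.inl hd)]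
  exact measure_mono_null (image_preimage_subset _ _) hS

variable {T : Current Ω (k + 1)} {τ : Ω → MultiVec n (k + 1)} {μ : Measure Ω}
  {τ' : Ω → MultiVec n k} {μ' : Measure Ω}

theorem Current.setIntegral_wedge_boundary_eq_zero (hτ : T.IsRepresentedBy τ μ)
    (hτ' : T.boundary.IsRepresentedBy τ' μ') {α : ℝ} (hα : 1 ≤ α)
    (hμ : μ ≪ Measure.hausdorffMeasure α) {v : RSpace n → RSpace n} (hv : ContDiffOn ℝ 1 v Ω)
    (hvτ : ∀ᵐ x : Ω ∂μ, vecWedge (v x) (τ x) = 0) (η : Covec n (k + 1)) {F : Set Ω}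
    (hF : IsCompact F) (hF0 : μH[α - 1] F = 0) :
    IntegrableOn (fun x : Ω => multiPairing (vecWedge (v x) (τ' x)) η) F μ' ∧
      ∫ x in F, multiPairing (vecWedge (v x) (τ' x)) η ∂μ' = 0 := by
  set F' : Set (RSpace n) := (↑) '' F
  have hF' : IsCompact F' := hF.image continuous_subtype_val
  have hpre : ((↑) ⁻¹' F' : Set Ω) = F := preimage_image_eq _ Subtype.val_injective
  have hF'0 : μH[α - 1] F' = 0 := by
    rwa [isometry_subtype_coe.hausdorffMeasure_image (Or.inl (by linarith))]
  obtain ⟨χ, hχ, hχc, hχΩ, hχ1⟩ := exists_contDiff_cutoff hF' Ω.isOpen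
    (image_subset_iff.2 fun x _ => x.2)
  -- The cutoff field is globally `C¹`, bounded and Lipschitz, hence has a global flow; it still
  -- annihilates `τ` and equals `v` on `F`.
  set w : RSpace n → RSpace n := fun x => χ x • v x
  have hws : tsupport w ⊆ tsupport χ := tsupport_smul_subset_left _ _
  have hwc : HasCompactSupport w := hχc.smul_right
  have hw : ContDiff ℝ 1 w := contDiff_of_tsupport_subset_isOpen Ω.isOpen
    ((hχ.of_le (by simp)).contDiffOn.smul hv) (hws.trans hχΩ)
  obtain ⟨K, hK⟩ := hw.lipschitzWith_of_hasCompactSupport hwc (by simp)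
  obtain ⟨C, hC⟩ := hwc.exists_bound_of_continuous hw.continuous
  have hM (x) : ‖w x‖ ≤ C.toNNReal := (hC x).trans (Real.le_coe_toNNReal C)
  have hwτ : ∀ᵐ x : Ω ∂μ, vecWedge (w x) (τ x) = 0 := by
    filter_upwards [hvτ] with x hx
    rw [vecWedge_smul, hx, smul_zero]
  obtain ⟨hb, c, hc, hid⟩ :=
    Current.integral_wedge_boundary hτ hτ' hw hwc (hws.trans hχΩ) hwτ η
  have H : LieIdentity ((↑) : Ω → RSpace n) w μ μ' (fun x => multiPairing (τ x) η)
      (fun x => multiPairing (vecWedge (w x) (τ' x)) η) c :=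
    ⟨continuous_subtype_val, hτ.integrable η, hb, hc, hid⟩
  obtain ⟨Φ, hΦ⟩ := exists_isGlobalFlow hw hK hM
  have hnull : μ ((↑) ⁻¹' sweep Φ (Icc (-1) 1) F' : Set Ω) = 0 := by
    refine hμ (hausdorffMeasure_coe_preimage_eq_zero (by linarith) ?_)
    simpa using hausdorffMeasure_sweep_eq_zero hΦ hK hM (by linarith) hF'0
  have hint := H.setIntegral_eq_zero hK hM hΦ hF' hnull
  rw [hpre] at hint
  have heq : EqOn (fun x : Ω => multiPairing (vecWedge (w x) (τ' x)) η)
      (fun x : Ω => multiPairing (vecWedge (v x) (τ' x)) η) F := fun x hx => by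
    simp only [w]
    rw [hχ1 x (mem_image_of_mem _ hx), one_smul]
  exact ⟨hb.integrableOn.congr_fun heq hF.measurableSet,
    (setIntegral_congr_fun hF.measurableSet heq).symm.trans hint⟩

theorem Current.aestronglyMeasurable_wedge (hτ : T.boundary.IsRepresentedBy τ' μ')
    {v : RSpace n → RSpace n} (hv : ContinuousOn v Ω) (η : Covec n (k + 1)) :
    AEStronglyMeasurable (fun x : Ω => multiPairing (vecWedge (v x) (τ' x)) η) μ' := by
  have h : (fun x : Ω => multiPairing (vecWedge (v x) (τ' x)) η) = fun x : Ω =>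
      ∑ i, v x i * multiPairing (τ' x) (η.curryLeft (EuclideanSpace.single i 1)) := by
    funext x
    rw [multiPairing_vecWedge, multiPairing_curryLeft]
  rw [h]
  have hvc : Continuous fun x : Ω => v x := continuousOn_iff_continuous_domRestrict.1 hv
  have hvi (i : Fin n) : Continuous fun x : Ω => v x i :=
    (EuclideanSpace.proj i : RSpace n →L[ℝ] ℝ).continuous.comp hvc
  exact Finset.aestronglyMeasurable_fun_sum _ fun i _ =>
    (hvi i).aestronglyMeasurable.mul (hτ.integrable _).aestronglyMeasurable

end Main

end

theorem mainTheorem8 (n k : ℕ) (Ω : Opens (RSpace n))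
    (T : Current Ω (k + 1)) (hT : T.IsNormal)
    (τ : Ω → MultiVec n (k + 1)) (μ : Measure Ω) (hτ : T.IsRepresentedBy τ μ)
    (τ' : Ω → MultiVec n k) (μ' : Measure Ω) (hτ' : T.boundary.IsRepresentedBy τ' μ')
    (α : ℝ) (hα : α ∈ Icc ((k + 1 : ℕ) : ℝ) (n : ℝ))
    (hμ : μ ≪ Measure.hausdorffMeasure α)
    (v : RSpace n → RSpace n) (hv : ContDiffOn ℝ 1 v Ω)
    (hvτ : ∀ᵐ x : Ω ∂μ, vecWedge (v x) (τ x) = 0) :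
    μ'.restrict {x : Ω | vecWedge (v x) (τ' x) ≠ 0} ≪ Measure.hausdorffMeasure (α - 1) := by
  have hα1 : 1 ≤ α := by
    refine le_trans ?_ hα.1
    push_cast
    linarith [k.cast_nonneg (α := ℝ)]
  have := hτ'.locallyFinite
  have : LocallyCompactSpace Ω := Ω.isOpen.locallyCompactSpace
  -- Supplies inner regularity of `μ'` by compact sets.
  have : SigmaCompactSpace Ω := sigmaCompactSpace_of_locallyCompact_secondCountable
  obtain ⟨ι, _, η, hη⟩ := exists_finite_separating_covec n (k + 1)
  refine Measure.AbsolutelyContinuous.mk fun A hA hA0 => ?_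
  rw [Measure.restrict_apply hA]
  have hb i := Current.aestronglyMeasurable_wedge hτ' hv.continuousOn (η i)
  have hcompact i (F : Set Ω) (hFA : F ⊆ A) (hF : IsCompact F) :=
    Current.setIntegral_wedge_boundary_eq_zero hτ hτ' hα1 hμ hv hvτ (η i) hF
      (measure_mono_null hFA hA0)
  have hpos i := measure_inter_pos_eq_zero_of_isCompact (hb i) hA (hcompact i)
  have hneg i := measure_inter_pos_eq_zero_of_isCompact (hb i).neg hA fun F hFA hF =>
    ⟨(hcompact i F hFA hF).1.neg, by
      simp only [Pi.neg_apply]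
      rw [integral_neg, (hcompact i F hFA hF).2, neg_zero]⟩
  -- Where `v ∧ τ'` is nonzero, one of the finitely many scalar pairings is positive or negative.
  refine measure_mono_null (fun x hx => ?_)
    (measure_iUnion_null fun i => measure_union_null (hpos i) (hneg i))
  obtain ⟨hxA, hxE⟩ := hx
  obtain ⟨i, hi⟩ : ∃ i, multiPairing (vecWedge (v x) (τ' x)) (η i) ≠ 0 := by
    by_contra! hall
    exact hxE (hη _ hall)
  refine mem_iUnion.2 ⟨i, ?_⟩
  rcases hi.lt_or_gt with h | h
  · exact Or.inr ⟨hxA, by simpa using h⟩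
  · exact Or.inl ⟨hxA, h⟩
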